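/- **Theorem (Entanglement distillation).** Let $\varphi^{AB}=|\psi\rangle\langle\psi|$ be a pure state on $\mathbb{C}^{d_A}\otimes\mathbb{C}^{d_B}$ ($\psi$ a unit vector). Let $N\ge 2$, and let $\varrho_{\psi_1}=|\psi_1\rangle\langle\psi_1|$ with $|\psi_1\rangle=\frac1{\sqrt N}\sum_{i=0}^{N-1}|i\rangle^A\otimes|i\rangle^B$ be the maximally entangled state of local dimension $N$. Write $S(\varrho)=-\mathrm{Tr}(\varrho\log_2\varrho)$, and $\|X\|_1=\mathrm{Tr}\sqrt{X^\dagger X}$ for the trace norm. An LOCC map is a map realised by finitely many rounds, in each of which one party performs a local measurement (given by Kraus operators $K_j$ with $\sum_j K_j^\dagger K_j=\mathbf 1$, possibly with a different output space) and communicates the outcome to the other party, the later rounds being allowed to depend on it; the outcomes are forgotten in the end. A *distillation scheme* for $\varphi^{AB}$ consists of numbers $n_m\in\mathbb{N}$ and of LOCC maps $T_m$ ($m\in\mathbb{N}$), from operators on $(\mathbb{C}^{d_A})^{\otimes m}\otimes(\mathbb{C}^{d_B})^{\otimes m}$ to operators on $(\mathbb{C}^{N})^{\otimes n_m}\otimes(\mathbb{C}^{N})^{\otimes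 n_m}$, such that $$\lim_{m\to\infty}\bigl\|T_m\bigl((\varphi^{AB})^{\otimes m}\bigr)-(\varrho_{\psi_1})^{\otimes n_m}\bigr\|_1=0 .$$ Then: 1. $S(\mathrm{Tr}_B\,\varphi^{AB})=S(\mathrm{Tr}_A\,\varphi^{AB})$. 2. There is a distillation scheme with $$\lim_{m\to\infty}\frac{n_m}{m}=\frac{S(\mathrm{Tr}_B\,\varphi^{AB})}{\log_2 N},$$ and, if $S(\mathrm{Tr}_B\,\varphi^{AB})\le\log_2 N$ (for example, if $\min(d_A,d_B)\le N$), with $n_m\le m$ for all $m$. For two-qubit maximally entangled pairs, $N=2$, the rate is $S(\mathrm{Tr}_B\,\varphi^{AB})$. 3. No distillation scheme has a larger rate: for every distillation scheme and every $\varepsilon>0$, one has $\frac{n_m}{m}\le \frac{S(\mathrm{Tr}_B\,\varphi^{AB})}{\log_2 N}+\varepsilon$ for all sufficiently large $m$. -/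

import Mathlib

open Matrix Filter Topology
open scoped Kronecker BigOperators

noncomputable section

namespace EntanglementDistillation

/-- Operators on the bipartite space `ℂ^A ⊗ ℂ^B`, in the product basis indexed by `A × B`. -/
abbrev BipartiteOp (A B : Type) : Type := Matrix (A × B) (A × B) ℂ

/-- A (bipartite) pure state: the rank-one projector `|ψ⟩⟨ψ|` onto a unit vector `ψ`. -/
def IsPureState {I : Type} [Fintype I] (φ : Matrix I I ℂ) : Prop :=
  ∃ ψ : I → ℂ, ∑ i, ‖ψ i‖ ^ 2 = 1 ∧ φ = vecMulVec ψ (star ψ)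

/-- The reduced operator `Tr_B ρ` on the first system. -/
def partialTraceB {A B : Type} [Fintype B] (ρ : BipartiteOp A B) : Matrix A A ℂ :=
  Matrix.of fun a a' => ∑ b, ρ (a, b) (a', b)

/-- The reduced operator `Tr_A ρ` on the second system. -/
def partialTraceA {A B : Type} [Fintype A] (ρ : BipartiteOp A B) : Matrix B B ℂ :=
  Matrix.of fun b b' => ∑ a, ρ (a, b) (a, b')

/-- The von Neumann entropy `S(ρ) = -Tr (ρ log₂ ρ)`; here `log₂ ρ` is given by the functional
calculus, and `0 log₂ 0 = 0`. -/
def vonNeumannEntropy {I : Type} [Fintype I] [DecidableEq I] (ρ : Matrix I I ℂ) : ℝ :=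
  -(ρ * cfc (Real.logb 2) ρ).trace.re

/-- The trace norm `‖X‖₁ = Tr √(X† X)`. -/
def traceNorm {I : Type} [Fintype I] [DecidableEq I] (X : Matrix I I ℂ) : ℝ :=
  (cfc Real.sqrt (Xᴴ * X)).trace.re

/-- The `m`-fold tensor power of a bipartite operator, regrouped as an operator on
`(ℂ^A)^{⊗m} ⊗ (ℂ^B)^{⊗m}`: all first factors belong to one party, all second factors to the
other one. -/
def tensorPower {A B : Type} (ρ : BipartiteOp A B) (m : ℕ) :
    BipartiteOp (Fin m → A) (Fin m → B) :=
  Matrix.of fun x y => ∏ i, ρ (x.1 i, x.2 i) (y.1 i, y.2 i)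

/-- The vector `N^{-1/2} ∑ i, |i⟩ ⊗ |i⟩`. -/
def maxEntangledVector (N : ℕ) : Fin N × Fin N → ℂ :=
  fun x => if x.1 = x.2 then ((Real.sqrt N)⁻¹ : ℝ) else 0

/-- The maximally entangled state of local dimension `N`. -/
def maxEntangled (N : ℕ) : BipartiteOp (Fin N) (Fin N) :=
  vecMulVec (maxEntangledVector N) (star (maxEntangledVector N))

/-- Maps realised by a (finite) protocol of local operations and classical communication with
output systems `A'`, `B'`. Either nothing is done, or one party performs a local measurement with
Kraus operators `K j` (whose output space may differ from the input space), tells the outcome `j`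
to the other one, and both go on with a protocol `T j` that may depend on `j`. The outcomes are
forgotten in the end. A local channel, in particular a local unitary, the addition of an ancilla
or the discarding of a subsystem, is such a measurement after which `T j` does not depend on `j`. -/
inductive IsLOCC {A' B' : Type} [Fintype A'] [Fintype B'] [DecidableEq A'] [DecidableEq B'] :
    ∀ {A B : Type} [Fintype A] [Fintype B] [DecidableEq A] [DecidableEq B],
      (BipartiteOp A B → BipartiteOp A' B') → Prop
  | done : IsLOCC (fun ρ : BipartiteOp A' B' => ρ)
  | alice {A B C J : Type} [Fintype A] [Fintype B] [Fintype C] [Fintype J]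
      [DecidableEq A] [DecidableEq B] [DecidableEq C]
      (K : J → Matrix C A ℂ) (hK : ∑ j, (K j)ᴴ * K j = 1)
      (T : J → BipartiteOp C B → BipartiteOp A' B') (hT : ∀ j, IsLOCC (T j)) :
      IsLOCC (fun ρ : BipartiteOp A B =>
        ∑ j, T j ((K j ⊗ₖ (1 : Matrix B B ℂ)) * ρ * (K j ⊗ₖ (1 : Matrix B B ℂ))ᴴ))
  | bob {A B C J : Type} [Fintype A] [Fintype B] [Fintype C] [Fintype J]
      [DecidableEq A] [DecidableEq B] [DecidableEq C]
      (K : J → Matrix C B ℂ) (hK : ∑ j, (K j)ᴴ * K j = 1)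
      (T : J → BipartiteOp A C → BipartiteOp A' B') (hT : ∀ j, IsLOCC (T j)) :
      IsLOCC (fun ρ : BipartiteOp A B =>
        ∑ j, T j (((1 : Matrix A A ℂ) ⊗ₖ K j) * ρ * ((1 : Matrix A A ℂ) ⊗ₖ K j)ᴴ))

/-- A distillation scheme for `φ`: for every number `m` of copies of `φ`, a map `T m` realised by
LOCC that produces `n m` copies of the maximally entangled state of local dimension `N`, with an
error that vanishes in trace norm as `m → ∞`. -/
def IsDistillationScheme {dA dB : ℕ} (φ : BipartiteOp (Fin dA) (Fin dB)) (N : ℕ) (n : ℕ → ℕ)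
    (T : ∀ m : ℕ, BipartiteOp (Fin m → Fin dA) (Fin m → Fin dB) →
      BipartiteOp (Fin (n m) → Fin N) (Fin (n m) → Fin N)) : Prop :=
  (∀ m, IsLOCC (T m)) ∧
    Tendsto (fun m => traceNorm (T m (tensorPower φ m) - tensorPower (maxEntangled N) (n m)))
      atTop (𝓝 0)

end EntanglementDistillation

end

/-! Write a vector of `ℂ^X ⊗ ℂ^Y` as its coefficient matrix `M`. A product operator `A ⊗ B` acts by
`M ↦ A M Bᵀ`, the Schmidt rank is the rank of `M`, and the squared Schmidt coefficients are the
eigenvalues of `M Mᴴ`. For `m` copies they are the probabilities of strings of `m` independent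
letters, and Chebyshev's inequality for the surprisal puts most of the weight on strings of
probability about `2^(-mS)`. The two reduced states have equal entropy because `M Mᴴ` and `Mᴴ M`
share their nonzero spectrum.

Achievability is entanglement concentration. The probability of a string depends only on its letter
counts, so it takes polynomially many values. Each level set of positive probability is cut into
blocks of exactly `N^n` strings (`exists_blocks`). Alice measures the block, and a vector that is
flat on a block is locally equivalent to `n` maximally entangled pairs (`LOCCReaches_maxState`).
Each level loses fewer than `N^n` strings; with `n log₂ N` slightly below `mS` the lost weight,
which controls the error (`exists_LOCC_traceNorm_le`), vanishes.

The converse uses only that LOCC maps have product Kraus operators (`IsLOCC.exists_kraus`), which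
cannot raise the Schmidt rank. A vector `G` overlaps the maximally entangled one by `|tr G|² / N^n`,
at most its squared norm times `rank G / N^n` (`norm_trace_sq_le_rank_mul_sqNorm`). Up to a small
vector, the `m` copies have Schmidt rank at most `2^(m(S+δ))`, so an accurate output forces `N^n` to
be at most a constant times this. -/

namespace EntanglementDistillation

open scoped ComplexOrder

/-! ### Spectral formulas for entropy and trace norm -/

section Spectral

variable {I : Type} [Fintype I] [DecidableEq I] {A : Matrix I I ℂ}

lemma trace_conjStarAlgAut (U : unitary (Matrix I I ℂ)) (D : Matrix I I ℂ) :
    (Unitary.conjStarAlgAut ℂ _ U D).trace = D.trace := by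
  rw [Unitary.conjStarAlgAut_apply, Matrix.trace_mul_comm, ← Matrix.mul_assoc,
    Unitary.coe_star_mul_self, Matrix.one_mul]

lemma trace_cfc (hA : A.IsHermitian) (f : ℝ → ℝ) :
    (cfc f A).trace.re = ∑ i, f (hA.eigenvalues i) := by
  rw [hA.cfc_eq f, Matrix.IsHermitian.cfc, trace_conjStarAlgAut, Matrix.trace_diagonal]
  simp

lemma vonNeumannEntropy_eq_sum_eigenvalues (hA : A.IsHermitian) :
    vonNeumannEntropy A = ∑ i, -(hA.eigenvalues i * Real.logb 2 (hA.eigenvalues i)) := by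
  have h : A * cfc (Real.logb 2) A = Unitary.conjStarAlgAut ℂ _ hA.eigenvectorUnitary
      (Matrix.diagonal fun i => ((hA.eigenvalues i * Real.logb 2 (hA.eigenvalues i) : ℝ) : ℂ)) := by
    rw [hA.cfc_eq, Matrix.IsHermitian.cfc]
    conv_lhs => enter [1]; rw [hA.spectral_theorem]
    rw [← map_mul, Matrix.diagonal_mul_diagonal]
    simp
  rw [vonNeumannEntropy, h, trace_conjStarAlgAut, Matrix.trace_diagonal, Complex.re_sum,
    ← Finset.sum_neg_distrib]
  simp only [Complex.ofReal_re]

/-- Roots counted with multiplicity allow a comparison between matrices of different sizes, as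
needed for `M Mᴴ` and `Mᴴ M`. -/
lemma vonNeumannEntropy_eq_sum_roots (hA : A.IsHermitian) :
    vonNeumannEntropy A =
      (A.charpoly.roots.map fun z => -(z.re * Real.logb 2 z.re)).sum := by
  rw [vonNeumannEntropy_eq_sum_eigenvalues hA, hA.roots_charpoly_eq_eigenvalues]
  simp

lemma traceNorm_eq_sum_abs_eigenvalues (hA : A.IsHermitian) :
    traceNorm A = ∑ i, |hA.eigenvalues i| := by
  have h : Aᴴ * A = cfc (fun x : ℝ => x ^ 2) A := by
    rw [hA.eq, hA.cfc_eq, Matrix.IsHermitian.cfc]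
    conv_lhs => rw [hA.spectral_theorem]
    rw [← map_mul, Matrix.diagonal_mul_diagonal]
    congr 2
    ext i
    simp [pow_two]
  have hsa : IsSelfAdjoint A := hA
  rw [traceNorm, h, ← cfc_comp' Real.sqrt (fun x : ℝ => x ^ 2) A, trace_cfc hA]
  simp only [Real.sqrt_sq_eq_abs]

lemma traceNorm_nonneg (hA : A.IsHermitian) : 0 ≤ traceNorm A := by
  rw [traceNorm_eq_sum_abs_eigenvalues hA]
  exact Finset.sum_nonneg fun _ _ => abs_nonneg _

/-- Diagonalization of a Hermitian matrix by a unitary matrix. -/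
lemma exists_unitary_conj_eq_diagonal (hA : A.IsHermitian) :
    ∃ U : Matrix I I ℂ, Uᴴ * U = 1 ∧ U * Uᴴ = 1 ∧
      A = U * diagonal (fun i => (hA.eigenvalues i : ℂ)) * Uᴴ := by
  refine ⟨hA.eigenvectorUnitary, ?_, ?_, ?_⟩
  · exact Unitary.coe_star_mul_self hA.eigenvectorUnitary
  · exact Unitary.coe_mul_star_self hA.eigenvectorUnitary
  · conv_lhs => rw [hA.spectral_theorem]
    rfl

/-- The trace norm of a difference of positive operators is at most the sum of their traces. -/
lemma traceNorm_sub_le {P Q : Matrix I I ℂ} (hP : P.PosSemidef) (hQ : Q.PosSemidef) :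
    traceNorm (P - Q) ≤ P.trace.re + Q.trace.re := by
  have hA : (P - Q).IsHermitian := hP.1.sub hQ.1
  obtain ⟨U, hU, hU', h⟩ := exists_unitary_conj_eq_diagonal hA
  -- In the eigenbasis of `P - Q` each eigenvalue is a difference of two nonnegative diagonal
  -- entries, so its modulus is at most their sum.
  have hd : diagonal (fun i => (hA.eigenvalues i : ℂ)) = Uᴴ * P * U - Uᴴ * Q * U := by
    calc diagonal (fun i => (hA.eigenvalues i : ℂ))
        = (Uᴴ * U) * diagonal (fun i => (hA.eigenvalues i : ℂ)) * (Uᴴ * U) := by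
          rw [hU, Matrix.one_mul, Matrix.mul_one]
      _ = Uᴴ * (U * diagonal (fun i => (hA.eigenvalues i : ℂ)) * Uᴴ) * U := by
          simp only [Matrix.mul_assoc]
      _ = Uᴴ * (P - Q) * U := by rw [← h]
      _ = _ := by rw [Matrix.mul_sub, Matrix.sub_mul]
  have htr : ∀ R : Matrix I I ℂ, R.trace = (Uᴴ * R * U).trace := fun R => by
    rw [Matrix.trace_mul_comm, ← Matrix.mul_assoc, hU', Matrix.one_mul]
  have hnn : ∀ {R : Matrix I I ℂ}, R.PosSemidef → ∀ i, 0 ≤ ((Uᴴ * R * U) i i).re := fun hR i =>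
    (Complex.le_def.1 ((hR.conjTranspose_mul_mul_same U).diag_nonneg (i := i))).1
  rw [traceNorm_eq_sum_abs_eigenvalues hA, htr P, htr Q, Matrix.trace, Matrix.trace,
    Complex.re_sum, Complex.re_sum, ← Finset.sum_add_distrib]
  refine Finset.sum_le_sum fun i _ => ?_
  have hi : hA.eigenvalues i = ((Uᴴ * P * U) i i).re - ((Uᴴ * Q * U) i i).re := by
    have := congrArg (fun R : Matrix I I ℂ => (R i i).re) hd
    simpa using this
  rw [hi, Matrix.diag_apply, Matrix.diag_apply]
  have h1 := hnn hP i
  have h2 := hnn hQ i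
  exact abs_le.2 ⟨by linarith, by linarith⟩

/-- The quadratic form of a Hermitian operator at a unit vector is bounded by the trace norm. -/
lemma neg_traceNorm_le_re_dotProduct (hA : A.IsHermitian) (v : I → ℂ)
    (hv : ∑ i, ‖v i‖ ^ 2 = 1) :
    -traceNorm A ≤ (star v ⬝ᵥ (A *ᵥ v)).re := by
  obtain ⟨U, hU, hU', h⟩ := exists_unitary_conj_eq_diagonal hA
  set w : I → ℂ := Uᴴ *ᵥ v with hw
  have hnorm : ∀ u : I → ℂ, (star u ⬝ᵥ u) = ((∑ i, ‖u i‖ ^ 2 : ℝ) : ℂ) := fun u => by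
    rw [dotProduct, Complex.ofReal_sum]
    refine Finset.sum_congr rfl fun i _ => ?_
    rw [Pi.star_apply, mul_comm, Complex.star_def, Complex.mul_conj, Complex.normSq_eq_norm_sq]
  have hsw : star w = star v ᵥ* U := by
    rw [hw, star_mulVec, conjTranspose_conjTranspose]
  have hw1 : ∑ i, ‖w i‖ ^ 2 = 1 := by
    have h1 : star w ⬝ᵥ w = star v ⬝ᵥ v := by
      rw [hsw, hw, ← dotProduct_mulVec, mulVec_mulVec, hU', one_mulVec]
    rw [hnorm, hnorm, hv] at h1
    exact_mod_cast h1
  have hq : (star v ⬝ᵥ (A *ᵥ v)).re = ∑ i, hA.eigenvalues i * ‖w i‖ ^ 2 := by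
    have h1 : star v ⬝ᵥ (A *ᵥ v) =
        star w ⬝ᵥ (diagonal (fun i => (hA.eigenvalues i : ℂ)) *ᵥ w) := by
      conv_lhs => rw [h]
      rw [hsw, hw, ← dotProduct_mulVec, mulVec_mulVec, mulVec_mulVec, Matrix.mul_assoc]
    rw [h1, dotProduct, Complex.re_sum]
    refine Finset.sum_congr rfl fun i _ => ?_
    rw [mulVec_diagonal, Pi.star_apply, Complex.star_def, mul_left_comm, mul_comm _ (w i),
      Complex.mul_conj, Complex.normSq_eq_norm_sq, ← Complex.ofReal_mul, Complex.ofReal_re]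
  rw [hq, traceNorm_eq_sum_abs_eigenvalues hA, ← Finset.sum_neg_distrib]
  refine Finset.sum_le_sum fun i _ => ?_
  have h1 : ‖w i‖ ^ 2 ≤ 1 := by
    rw [← hw1]
    exact Finset.single_le_sum (f := fun i => ‖w i‖ ^ 2) (fun _ _ => by positivity)
      (Finset.mem_univ i)
  have h2 := neg_abs_le (hA.eigenvalues i * ‖w i‖ ^ 2)
  rw [abs_mul, abs_of_nonneg (by positivity : 0 ≤ ‖w i‖ ^ 2)] at h2
  nlinarith [abs_nonneg (hA.eigenvalues i)]

end Spectral

/-! ### Bipartite vectors as coefficient matrices -/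

/-- `M Mᴴ` and `(Mᴴ M)ᵀ` have the same entropy. -/
lemma vonNeumannEntropy_mul_conjTranspose {X Y : Type} [Fintype X] [Fintype Y] [DecidableEq X]
    [DecidableEq Y] (M : Matrix X Y ℂ) :
    vonNeumannEntropy (M * Mᴴ) = vonNeumannEntropy (Mᴴ * M)ᵀ := by
  have h1 : (M * Mᴴ).IsHermitian := isHermitian_mul_conjTranspose_self M
  have h2 : (Mᴴ * M).IsHermitian := isHermitian_conjTranspose_mul_self M
  rw [vonNeumannEntropy_eq_sum_roots h1, vonNeumannEntropy_eq_sum_roots h2.transpose,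
    charpoly_transpose]
  -- The characteristic polynomials agree up to powers of `X`; the additional roots are 0 and
  -- contribute `0 * logb 2 0 = 0`.
  have key := congrArg Polynomial.roots (charpoly_mul_comm' M Mᴴ)
  have hX : ∀ n : ℕ, (Polynomial.X ^ n : Polynomial ℂ) ≠ 0 := fun n =>
    pow_ne_zero n Polynomial.X_ne_zero
  rw [Polynomial.roots_mul (mul_ne_zero (hX _) (charpoly_monic _).ne_zero),
    Polynomial.roots_mul (mul_ne_zero (hX _) (charpoly_monic _).ne_zero)] at key
  have := congrArg (fun s => (s.map fun z : ℂ => -(z.re * Real.logb 2 z.re)).sum) key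
  simpa [Multiset.map_nsmul, Multiset.sum_nsmul] using this

/-- The operator `|M⟩⟨M|` for the vector in `ℂ^X ⊗ ℂ^Y` with the matrix `M` of coefficients. -/
def vecProj {X Y : Type} (M : Matrix X Y ℂ) : BipartiteOp X Y :=
  vecMulVec (fun x => M x.1 x.2) (star fun x => M x.1 x.2)

lemma vecProj_apply {X Y : Type} (M : Matrix X Y ℂ) (x y : X × Y) :
    vecProj M x y = M x.1 x.2 * star (M y.1 y.2) := rfl

lemma partialTraceB_vecProj {X Y : Type} [Fintype Y] (M : Matrix X Y ℂ) :
    partialTraceB (vecProj M) = M * Mᴴ := by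
  ext a a'
  simp [partialTraceB, vecProj_apply, Matrix.mul_apply]

lemma partialTraceA_vecProj {X Y : Type} [Fintype X] (M : Matrix X Y ℂ) :
    partialTraceA (vecProj M) = (Mᴴ * M)ᵀ := by
  ext a a'
  simp [partialTraceA, vecProj_apply, Matrix.mul_apply, mul_comm]

section

variable {X Y X' Y' : Type} [Fintype X] [Fintype Y]

lemma kronecker_mulVec_uncurry (A : Matrix X' X ℂ) (B : Matrix Y' Y ℂ) (M : Matrix X Y ℂ) :
    (A ⊗ₖ B) *ᵥ (fun x => M x.1 x.2) = fun x => (A * M * Bᵀ) x.1 x.2 := by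
  ext ⟨a, b⟩
  simp only [mulVec, dotProduct, Matrix.mul_apply, kroneckerMap_apply, transpose_apply,
    Fintype.sum_prod_type, Finset.sum_mul]
  rw [Finset.sum_comm]
  exact Finset.sum_congr rfl fun _ _ => Finset.sum_congr rfl fun _ _ => by ring

/-- Rank-one operators stay rank-one under product Kraus operators, so every measurement branch can
be followed through its coefficient matrix. -/
lemma kronecker_mul_vecProj (A : Matrix X' X ℂ) (B : Matrix Y' Y ℂ) (M : Matrix X Y ℂ) :
    (A ⊗ₖ B) * vecProj M * (A ⊗ₖ B)ᴴ = vecProj (A * M * Bᵀ) := by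
  rw [vecProj, vecProj, mul_vecMulVec, vecMulVec_mul, ← star_mulVec, kronecker_mulVec_uncurry]

lemma vecProj_posSemidef (M : Matrix X Y ℂ) : (vecProj M).PosSemidef :=
  posSemidef_vecMulVec_self_star _

lemma trace_vecProj (M : Matrix X Y ℂ) :
    (vecProj M).trace = ((∑ x, ∑ y, ‖M x y‖ ^ 2 : ℝ) : ℂ) := by
  rw [Matrix.trace, Fintype.sum_prod_type]
  push_cast
  refine Finset.sum_congr rfl fun _ _ => Finset.sum_congr rfl fun _ _ => ?_
  rw [diag_apply, vecProj_apply, Complex.star_def, Complex.mul_conj, Complex.normSq_eq_norm_sq]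
  push_cast
  rfl

lemma trace_vecProj_eq (M : Matrix X Y ℂ) : (vecProj M).trace = (M * Mᴴ).trace := by
  rw [← partialTraceB_vecProj, Matrix.trace, Fintype.sum_prod_type]
  rfl

end

lemma vecProj_smul {X Y : Type} (c : ℂ) (M : Matrix X Y ℂ) :
    vecProj (c • M) = ((‖c‖ ^ 2 : ℝ) : ℂ) • vecProj M := by
  ext x y
  rw [← Complex.normSq_eq_norm_sq, ← Complex.mul_conj]
  simp [vecProj_apply]
  ring

lemma vecProj_zero {X Y : Type} : vecProj (0 : Matrix X Y ℂ) = 0 := by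
  ext x y
  simp [vecProj_apply]

/-! ### Tensor powers and maximally entangled states -/

/-- The tensor power of a matrix. -/
def matrixPower {X Y : Type} (M : Matrix X Y ℂ) (m : ℕ) : Matrix (Fin m → X) (Fin m → Y) ℂ :=
  Matrix.of fun x y => ∏ i, M (x i) (y i)

lemma matrixPower_mul {X Y W : Type} [Fintype Y] [DecidableEq Y] (M : Matrix X Y ℂ)
    (L : Matrix Y W ℂ) (m : ℕ) :
    matrixPower (M * L) m = matrixPower M m * matrixPower L m := by
  ext x y
  simp only [matrixPower, Matrix.of_apply, Matrix.mul_apply, Fintype.prod_sum,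
    ← Finset.prod_mul_distrib]

lemma matrixPower_conjTranspose {X Y : Type} (M : Matrix X Y ℂ) (m : ℕ) :
    matrixPower Mᴴ m = (matrixPower M m)ᴴ := by
  ext x y
  simp [matrixPower]

lemma matrixPower_diagonal {X : Type} [DecidableEq X] (p : X → ℂ) (m : ℕ) :
    matrixPower (diagonal p) m = diagonal fun x => ∏ i, p (x i) := by
  ext x y
  rw [matrixPower, Matrix.of_apply, diagonal_apply]
  split_ifs with h
  · subst h; simp
  · obtain ⟨i, hi⟩ := Function.ne_iff.1 h
    exact Finset.prod_eq_zero (Finset.mem_univ i) (diagonal_apply_ne _ hi)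

lemma matrixPower_one {X : Type} [DecidableEq X] (m : ℕ) :
    matrixPower (1 : Matrix X X ℂ) m = 1 := by
  rw [← diagonal_one, matrixPower_diagonal]
  simp

lemma tensorPower_vecProj {X Y : Type} (M : Matrix X Y ℂ) (m : ℕ) :
    tensorPower (vecProj M) m = vecProj (matrixPower M m) := by
  ext x y
  simp [tensorPower, vecProj_apply, matrixPower, Finset.prod_mul_distrib]

lemma maxEntangled_eq (N : ℕ) :
    maxEntangled N = vecProj (((Real.sqrt N)⁻¹ : ℂ) • (1 : Matrix (Fin N) (Fin N) ℂ)) := by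
  ext x y
  simp [maxEntangled, vecProj_apply, maxEntangledVector, vecMulVec_apply, Matrix.one_apply]

/-- The maximally entangled state on `ℂ^Z ⊗ ℂ^Z`. -/
noncomputable def maxState (Z : Type) [Fintype Z] [DecidableEq Z] : BipartiteOp Z Z :=
  vecProj (((Real.sqrt (Fintype.card Z))⁻¹ : ℂ) • (1 : Matrix Z Z ℂ))

lemma tensorPower_maxEntangled (N n : ℕ) :
    tensorPower (maxEntangled N) n = maxState (Fin n → Fin N) := by
  rw [maxEntangled_eq, tensorPower_vecProj, maxState]
  congr 1
  have h : (((Real.sqrt N)⁻¹ : ℂ) • (1 : Matrix (Fin N) (Fin N) ℂ)) =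
      diagonal fun _ => ((Real.sqrt N)⁻¹ : ℂ) := by
    rw [smul_one_eq_diagonal]
  rw [h, matrixPower_diagonal, smul_one_eq_diagonal]
  congr 1
  ext x
  have hs : √(N : ℝ) ^ n = √((N : ℝ) ^ n) := by
    rw [eq_comm, Real.sqrt_eq_iff_mul_self_eq (by positivity) (by positivity), ← mul_pow,
      Real.mul_self_sqrt (Nat.cast_nonneg N)]
  simp [← Complex.ofReal_pow, hs]

lemma trace_maxState (Z : Type) [Fintype Z] [DecidableEq Z] [Nonempty Z] :
    (maxState Z).trace = 1 := by
  have h : (0 : ℝ) < Fintype.card Z := by exact_mod_cast Fintype.card_pos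
  rw [maxState, vecProj_smul, Matrix.trace_smul, trace_vecProj_eq, conjTranspose_one, Matrix.mul_one,
    Matrix.trace_one, ← Complex.ofReal_inv, Complex.norm_real, Real.norm_eq_abs, sq_abs, inv_pow,
    Real.sq_sqrt h.le, smul_eq_mul, ← Complex.ofReal_natCast, ← Complex.ofReal_mul,
    inv_mul_cancel₀ h.ne', Complex.ofReal_one]

/-! ### Frobenius norm, trace and rank -/

/-- The squared Frobenius norm. -/
noncomputable def sqNorm {X Y : Type} [Fintype X] [Fintype Y] (M : Matrix X Y ℂ) : ℝ :=
  ∑ x, ∑ y, ‖M x y‖ ^ 2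

lemma mul_conjTranspose_self_apply_self {X Y : Type} [Fintype Y] (M : Matrix X Y ℂ) (x : X) :
    (M * Mᴴ) x x = ((∑ y, ‖M x y‖ ^ 2 : ℝ) : ℂ) := by
  rw [Matrix.mul_apply, Complex.ofReal_sum]
  refine Finset.sum_congr rfl fun y _ => ?_
  rw [conjTranspose_apply, Complex.star_def, Complex.mul_conj, Complex.normSq_eq_norm_sq]

section

variable {X Y : Type} [Fintype X] [Fintype Y]

lemma sqNorm_nonneg (M : Matrix X Y ℂ) : 0 ≤ sqNorm M :=
  Finset.sum_nonneg fun _ _ => Finset.sum_nonneg fun _ _ => by positivity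

lemma trace_vecProj_eq_sqNorm (M : Matrix X Y ℂ) : (vecProj M).trace = (sqNorm M : ℂ) :=
  trace_vecProj M

lemma sqNorm_eq_trace (M : Matrix X Y ℂ) : (sqNorm M : ℂ) = (M * Mᴴ).trace := by
  rw [← trace_vecProj_eq_sqNorm, trace_vecProj_eq]

end

lemma sqNorm_unitary_mul {X Y : Type} [Fintype X] [Fintype Y] [DecidableEq X]
    {U : Matrix X X ℂ} (hU : Uᴴ * U = 1) (M : Matrix X Y ℂ) : sqNorm (U * M) = sqNorm M := by
  have h : (sqNorm (U * M) : ℂ) = sqNorm M := by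
    rw [sqNorm_eq_trace, sqNorm_eq_trace, conjTranspose_mul, Matrix.mul_assoc,
      Matrix.trace_mul_comm, Matrix.mul_assoc, Matrix.mul_assoc, hU, Matrix.mul_one]
  exact_mod_cast h

/-- In an eigenbasis of `M Mᴴ` only as many rows of `M` as its rank are nonzero, so the trace has
that many diagonal terms, and Cauchy–Schwarz applies. -/
lemma norm_trace_sq_le_rank_mul_sqNorm {Z : Type} [Fintype Z] [DecidableEq Z]
    (M : Matrix Z Z ℂ) : ‖M.trace‖ ^ 2 ≤ M.rank * sqNorm M := by
  have hA : (M * Mᴴ).IsHermitian := isHermitian_mul_conjTranspose_self M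
  obtain ⟨U, hU, hU', h⟩ := exists_unitary_conj_eq_diagonal hA
  have hcard : ((Finset.univ.filter fun i => hA.eigenvalues i ≠ 0).card : ℝ) = M.rank := by
    rw [← rank_self_mul_conjTranspose, hA.rank_eq_card_non_zero_eigs, Fintype.card_subtype]
  generalize hA.eigenvalues = lam at h hcard
  set S : Finset Z := Finset.univ.filter fun i => lam i ≠ 0 with hS
  have hdiag : (Uᴴ * M) * (Uᴴ * M)ᴴ = diagonal fun i => (lam i : ℂ) := by
    rw [conjTranspose_mul, conjTranspose_conjTranspose, ← Matrix.mul_assoc, Matrix.mul_assoc Uᴴ, h,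
      Matrix.mul_assoc, Matrix.mul_assoc, hU, Matrix.mul_one, ← Matrix.mul_assoc, hU,
      Matrix.one_mul]
  have hrow : ∀ i, i ∉ S → ∀ z, (Uᴴ * M) i z = 0 := by
    intro i hi z
    have h0 : lam i = 0 := by simpa [hS] using hi
    have h1 := mul_conjTranspose_self_apply_self (Uᴴ * M) i
    rw [hdiag, diagonal_apply_eq, h0] at h1
    have h2 : ∑ y, ‖(Uᴴ * M) i y‖ ^ 2 = 0 := by exact_mod_cast h1.symm
    have h3 := (Finset.sum_eq_zero_iff_of_nonneg fun _ _ => by positivity).1 h2 z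
      (Finset.mem_univ z)
    exact norm_eq_zero.1 (pow_eq_zero_iff two_ne_zero |>.1 h3)
  have htr : M.trace = ∑ i ∈ S, (Uᴴ * M * U) i i := by
    have h1 : M.trace = (Uᴴ * M * U).trace := by
      rw [Matrix.trace_mul_comm, ← Matrix.mul_assoc, hU', Matrix.one_mul]
    rw [h1, Matrix.trace]
    refine (Finset.sum_subset (Finset.subset_univ S) fun i _ hi => ?_).symm
    rw [diag_apply, Matrix.mul_apply]
    exact Finset.sum_eq_zero fun z _ => by rw [hrow i hi z, zero_mul]
  have hnorm : sqNorm (Uᴴ * M * U) = sqNorm M := by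
    have h1 : (sqNorm (Uᴴ * M * U) : ℂ) = sqNorm M := by
      rw [sqNorm_eq_trace, sqNorm_eq_trace, conjTranspose_mul, Matrix.mul_assoc (Uᴴ * M),
        ← Matrix.mul_assoc U, hU', Matrix.one_mul, hdiag, h, Matrix.mul_assoc,
        Matrix.trace_mul_comm, Matrix.mul_assoc, hU, Matrix.mul_one]
    exact_mod_cast h1
  rw [htr, ← hcard, ← hnorm]
  have hle : ∑ i ∈ S, ‖(Uᴴ * M * U) i i‖ ^ 2 ≤ sqNorm (Uᴴ * M * U) := by
    refine (Finset.sum_le_sum_of_subset_of_nonneg (Finset.subset_univ S)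
      fun _ _ _ => by positivity).trans (Finset.sum_le_sum fun i _ => ?_)
    exact Finset.single_le_sum (f := fun z => ‖(Uᴴ * M * U) i z‖ ^ 2)
      (fun _ _ => by positivity) (Finset.mem_univ i)
  calc ‖∑ i ∈ S, (Uᴴ * M * U) i i‖ ^ 2 ≤ (∑ i ∈ S, ‖(Uᴴ * M * U) i i‖) ^ 2 := by
        gcongr
        exact norm_sum_le _ _
    _ ≤ S.card * ∑ i ∈ S, ‖(Uᴴ * M * U) i i‖ ^ 2 := sq_sum_le_card_mul_sum_sq
    _ ≤ _ := by gcongr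

/-! ### The fidelity bound for LOCC maps -/

/-- Every LOCC map is a separable map: its Kraus operators are tensor products. -/
lemma IsLOCC.exists_kraus {A' B' : Type} [Fintype A'] [Fintype B'] [DecidableEq A']
    [DecidableEq B'] {A B : Type} [Fintype A] [Fintype B] [DecidableEq A] [DecidableEq B]
    {T : BipartiteOp A B → BipartiteOp A' B'} (hT : IsLOCC T) :
    ∃ (J : Type) (_ : Fintype J) (K : J → Matrix A' A ℂ) (L : J → Matrix B' B ℂ),
      (∀ ρ, T ρ = ∑ j, (K j ⊗ₖ L j) * ρ * (K j ⊗ₖ L j)ᴴ) ∧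
        ∑ j, (K j ⊗ₖ L j)ᴴ * (K j ⊗ₖ L j) = 1 := by
  induction hT with
  | done => 
    refine ⟨Unit, inferInstance, fun _ => 1, fun _ => 1, fun ρ => ?_, ?_⟩ <;>
      rw [Fintype.sum_unique, one_kronecker_one, conjTranspose_one, Matrix.mul_one]
    rw [Matrix.one_mul]
  | @alice A B C J _ _ _ _ _ _ _ K hK T hT ih =>
    choose I hI P Q hT hPQ using ih
    refine ⟨Σ j, I j, inferInstance, fun j => P j.1 j.2 * K j.1, fun j => Q j.1 j.2, fun ρ => ?_, ?_⟩
    · rw [Fintype.sum_sigma]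
      refine Finset.sum_congr rfl fun j _ => ?_
      rw [hT]
      refine Finset.sum_congr rfl fun i _ => ?_
      have h : (P j i * K j) ⊗ₖ Q j i = (P j i ⊗ₖ Q j i) * (K j ⊗ₖ (1 : Matrix B B ℂ)) := by
        rw [← mul_kronecker_mul, Matrix.mul_one]
      rw [h, conjTranspose_mul]
      simp only [Matrix.mul_assoc]
    · rw [Fintype.sum_sigma]
      have h : ∀ j i, ((P j i * K j) ⊗ₖ Q j i)ᴴ * ((P j i * K j) ⊗ₖ Q j i) =
          (K j ⊗ₖ (1 : Matrix B B ℂ))ᴴ * ((P j i ⊗ₖ Q j i)ᴴ * (P j i ⊗ₖ Q j i)) *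
            (K j ⊗ₖ (1 : Matrix B B ℂ)) := fun j i => by
        have h : (P j i * K j) ⊗ₖ Q j i = (P j i ⊗ₖ Q j i) * (K j ⊗ₖ (1 : Matrix B B ℂ)) := by
          rw [← mul_kronecker_mul, Matrix.mul_one]
        rw [h, conjTranspose_mul]
        simp only [Matrix.mul_assoc]
      simp only [h, ← Matrix.mul_sum, ← Matrix.sum_mul, hPQ, Matrix.mul_one]
      simp only [conjTranspose_kronecker, ← mul_kronecker_mul, conjTranspose_one, Matrix.mul_one]
      rw [← one_kronecker_one, ← hK]
      ext x y
      simp [Matrix.sum_apply, kroneckerMap_apply, Finset.sum_mul]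
  | @bob A B C J _ _ _ _ _ _ _ K hK T hT ih =>
    choose I hI P Q hT hPQ using ih
    refine ⟨Σ j, I j, inferInstance, fun j => P j.1 j.2, fun j => Q j.1 j.2 * K j.1, fun ρ => ?_, ?_⟩
    · rw [Fintype.sum_sigma]
      refine Finset.sum_congr rfl fun j _ => ?_
      rw [hT]
      refine Finset.sum_congr rfl fun i _ => ?_
      have h : P j i ⊗ₖ (Q j i * K j) = (P j i ⊗ₖ Q j i) * ((1 : Matrix A A ℂ) ⊗ₖ K j) := by
        rw [← mul_kronecker_mul, Matrix.mul_one]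
      rw [h, conjTranspose_mul]
      simp only [Matrix.mul_assoc]
    · rw [Fintype.sum_sigma]
      have h : ∀ j i, (P j i ⊗ₖ (Q j i * K j))ᴴ * (P j i ⊗ₖ (Q j i * K j)) =
          ((1 : Matrix A A ℂ) ⊗ₖ K j)ᴴ * ((P j i ⊗ₖ Q j i)ᴴ * (P j i ⊗ₖ Q j i)) *
            ((1 : Matrix A A ℂ) ⊗ₖ K j) := fun j i => by
        have h : P j i ⊗ₖ (Q j i * K j) = (P j i ⊗ₖ Q j i) * ((1 : Matrix A A ℂ) ⊗ₖ K j) := by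
          rw [← mul_kronecker_mul, Matrix.mul_one]
        rw [h, conjTranspose_mul]
        simp only [Matrix.mul_assoc]
      simp only [h, ← Matrix.mul_sum, ← Matrix.sum_mul, hPQ, Matrix.mul_one]
      simp only [conjTranspose_kronecker, ← mul_kronecker_mul, conjTranspose_one, Matrix.mul_one]
      rw [← one_kronecker_one, ← hK]
      ext x y
      simp [Matrix.sum_apply, kroneckerMap_apply, Finset.mul_sum]

section

variable {Z : Type} [Fintype Z] [DecidableEq Z]

/-- The coefficient vector of the maximally entangled state `maxState Z`. -/
noncomputable def maxVector (Z : Type) [Fintype Z] [DecidableEq Z] : Z × Z → ℂ :=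
  fun x => (((Real.sqrt (Fintype.card Z))⁻¹ : ℂ) • (1 : Matrix Z Z ℂ)) x.1 x.2

lemma star_maxVector_dotProduct (G : Matrix Z Z ℂ) :
    star (maxVector Z) ⬝ᵥ (fun x => G x.1 x.2) = ((Real.sqrt (Fintype.card Z))⁻¹ : ℂ) * G.trace := by
  simp only [dotProduct, Fintype.sum_prod_type, Pi.star_apply, maxVector, Matrix.smul_apply,
    Matrix.one_apply, Matrix.trace, diag_apply, Finset.mul_sum]
  refine Finset.sum_congr rfl fun z _ => ?_
  rw [Finset.sum_eq_single z (fun w _ hw => by simp [Ne.symm hw]) (by simp)]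
  simp

lemma sum_norm_maxVector_sq [Nonempty Z] : ∑ x, ‖maxVector Z x‖ ^ 2 = 1 := by
  have h := trace_maxState Z
  rw [maxState, trace_vecProj] at h
  rw [Fintype.sum_prod_type]
  exact Complex.ofReal_injective (h.trans Complex.ofReal_one.symm)

/-- The quadratic form factors into an inner product and its conjugate; the inner product with the
maximally entangled vector is `tr G / √|Z|`. -/
lemma fidelity_vecProj (G : Matrix Z Z ℂ) :
    (star (maxVector Z) ⬝ᵥ (vecProj G *ᵥ maxVector Z)).re =
      ‖G.trace‖ ^ 2 / Fintype.card Z := by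
  have h : star (maxVector Z) ⬝ᵥ (vecProj G *ᵥ maxVector Z) =
      (star (maxVector Z) ⬝ᵥ fun x => G x.1 x.2) *
        star (star (maxVector Z) ⬝ᵥ fun x => G x.1 x.2) := by
    rw [← star_dotProduct, vecProj, vecMulVec_mulVec, dotProduct_smul]
    rw [op_smul_eq_smul, smul_eq_mul, mul_comm]
  rw [h, Complex.star_def, Complex.mul_conj, Complex.ofReal_re, Complex.normSq_eq_norm_sq,
    star_maxVector_dotProduct, norm_mul, mul_pow, ← Complex.ofReal_inv, Complex.norm_real,
    Real.norm_eq_abs, sq_abs, inv_pow, Real.sq_sqrt (Nat.cast_nonneg _)]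
  ring

lemma fidelity_maxState [Nonempty Z] :
    (star (maxVector Z) ⬝ᵥ (maxState Z *ᵥ maxVector Z)).re = 1 := by
  have h : (0 : ℝ) < Fintype.card Z := by exact_mod_cast Fintype.card_pos
  have h2 : √(Fintype.card Z : ℝ) ≠ 0 := (Real.sqrt_pos.2 h).ne'
  rw [maxState, fidelity_vecProj, Matrix.trace_smul, Matrix.trace_one, smul_eq_mul, norm_mul,
    mul_pow, ← Complex.ofReal_inv, Complex.norm_real,
    Real.norm_eq_abs, sq_abs, inv_pow, Real.sq_sqrt (Nat.cast_nonneg _), Complex.norm_natCast]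
  field_simp

/-- The fidelity with the maximally entangled state that LOCC can reach from a pure state which is
the sum of a vector of small Schmidt rank and a small vector. -/
lemma IsLOCC.fidelity_le {A B : Type} [Fintype A] [Fintype B] [DecidableEq A] [DecidableEq B]
    [Nonempty Z] {T : BipartiteOp A B → BipartiteOp Z Z} (hT : IsLOCC T) (M N : Matrix A B ℂ) :
    (star (maxVector Z) ⬝ᵥ (T (vecProj (M + N)) *ᵥ maxVector Z)).re ≤
      2 * (M.rank / Fintype.card Z) * sqNorm M + 2 * sqNorm N := by
  have hcard : (0 : ℝ) < Fintype.card Z := by exact_mod_cast Fintype.card_pos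
  obtain ⟨J, _, K, L, hTK, hKL⟩ := hT.exists_kraus
  -- Trace preservation: the squared norms of the branches add up to that of the input.
  have hsum : ∀ G : Matrix A B ℂ, ∑ j, sqNorm (K j * G * (L j)ᵀ) = sqNorm G := fun G => by
    have h : ((∑ j, sqNorm (K j * G * (L j)ᵀ) : ℝ) : ℂ) = sqNorm G := by
      rw [← trace_vecProj_eq_sqNorm G, ← Matrix.one_mul (vecProj G), ← hKL, Finset.sum_mul,
        Matrix.trace_sum, Complex.ofReal_sum]
      refine Finset.sum_congr rfl fun j _ => ?_
      rw [← trace_vecProj_eq_sqNorm, ← kronecker_mul_vecProj, Matrix.trace_mul_comm,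
        ← Matrix.mul_assoc]
    exact_mod_cast h
  have hF : (star (maxVector Z) ⬝ᵥ (T (vecProj (M + N)) *ᵥ maxVector Z)).re =
      ∑ j, ‖(K j * M * (L j)ᵀ).trace + (K j * N * (L j)ᵀ).trace‖ ^ 2 / Fintype.card Z := by
    rw [hTK, Matrix.sum_mulVec, dotProduct_sum, Complex.re_sum]
    refine Finset.sum_congr rfl fun j _ => ?_
    rw [kronecker_mul_vecProj, fidelity_vecProj, Matrix.mul_add, Matrix.add_mul, Matrix.trace_add]
  rw [hF, ← hsum M, ← hsum N, Finset.mul_sum, Finset.mul_sum, ← Finset.sum_add_distrib]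
  refine Finset.sum_le_sum fun j _ => ?_
  set P := K j * M * (L j)ᵀ with hP
  set Q := K j * N * (L j)ᵀ
  have h1 : ‖P.trace‖ ^ 2 ≤ M.rank * sqNorm P := by
    refine (norm_trace_sq_le_rank_mul_sqNorm P).trans ?_
    have : P.rank ≤ M.rank := (rank_mul_le_left _ _).trans (rank_mul_le_right _ _)
    have h0 := sqNorm_nonneg P
    gcongr
  -- The small vector may have full rank; the trivial rank bound just cancels the normalisation `1 /
  -- |Z|`.
  have h2 : ‖Q.trace‖ ^ 2 ≤ Fintype.card Z * sqNorm Q := by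
    refine (norm_trace_sq_le_rank_mul_sqNorm Q).trans ?_
    have : Q.rank ≤ Fintype.card Z := rank_le_card_width Q
    have h0 := sqNorm_nonneg Q
    gcongr
  have h3 : ‖P.trace + Q.trace‖ ^ 2 ≤ 2 * ‖P.trace‖ ^ 2 + 2 * ‖Q.trace‖ ^ 2 := by
    have := norm_add_le P.trace Q.trace
    nlinarith [norm_nonneg (P.trace + Q.trace), sq_nonneg (‖P.trace‖ - ‖Q.trace‖)]
  rw [div_le_iff₀ hcard]
  calc ‖P.trace + Q.trace‖ ^ 2 ≤ 2 * (M.rank * sqNorm P) + 2 * (Fintype.card Z * sqNorm Q) := by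
        linarith
    _ = _ := by field_simp

lemma IsLOCC.isHermitian {A B : Type} [Fintype A] [Fintype B] [DecidableEq A] [DecidableEq B]
    {T : BipartiteOp A B → BipartiteOp Z Z} (hT : IsLOCC T) {ρ : BipartiteOp A B}
    (hρ : ρ.IsHermitian) : (T ρ).IsHermitian := by
  obtain ⟨J, _, K, L, hTK, -⟩ := hT.exists_kraus
  rw [hTK, IsHermitian, conjTranspose_sum]
  exact Finset.sum_congr rfl fun j _ => isHermitian_mul_mul_conjTranspose _ hρ

/-- A lower bound for the trace distance between the output of an LOCC map and the maximally
entangled state. -/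
lemma IsLOCC.one_sub_traceNorm_le {A B : Type} [Fintype A] [Fintype B] [DecidableEq A]
    [DecidableEq B] [Nonempty Z] {T : BipartiteOp A B → BipartiteOp Z Z} (hT : IsLOCC T)
    (M N : Matrix A B ℂ) :
    1 - traceNorm (T (vecProj (M + N)) - maxState Z) ≤
      2 * (M.rank / Fintype.card Z) * sqNorm M + 2 * sqNorm N := by
  have h1 := neg_traceNorm_le_re_dotProduct
    ((hT.isHermitian (vecProj_posSemidef (M + N)).1).sub
      (vecProj_posSemidef (((Real.sqrt (Fintype.card Z))⁻¹ : ℂ) • (1 : Matrix Z Z ℂ))).1)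
    (maxVector Z) sum_norm_maxVector_sq
  change -traceNorm (T (vecProj (M + N)) - maxState Z) ≤
    (star (maxVector Z) ⬝ᵥ ((T (vecProj (M + N)) - maxState Z) *ᵥ maxVector Z)).re at h1
  rw [Matrix.sub_mulVec, dotProduct_sub, Complex.sub_re, fidelity_maxState] at h1
  linarith [hT.fidelity_le M N]

end

/-! ### Typical strings and the surprisal -/

section Typicality

variable {I : Type} [Fintype I]

lemma sum_prod_eq_one {p : I → ℝ} (hp1 : ∑ i, p i = 1) (m : ℕ) :
    ∑ x : Fin m → I, ∏ i, p (x i) = 1 := by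
  classical
  rw [← Fintype.prod_sum fun (_ : Fin m) (i : I) => p i]
  simp [hp1]

lemma sum_fin_succ_fun (m : ℕ) (f : (Fin (m + 1) → I) → ℝ) :
    ∑ x, f x = ∑ a : I, ∑ x : Fin m → I, f (Fin.cons a x) := by
  rw [← (Fin.consEquiv fun _ : Fin (m + 1) => I).sum_comp, Fintype.sum_prod_type]
  rfl

/-- The mean of a sum of independent centred variables. -/
lemma sum_prod_mul_sum {p Z : I → ℝ} (hp1 : ∑ i, p i = 1) (hZ : ∑ i, p i * Z i = 0) (m : ℕ) :
    ∑ x : Fin m → I, (∏ i, p (x i)) * ∑ i, Z (x i) = 0 := by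
  induction m with
  | zero => simp
  | succ m ih =>
    rw [sum_fin_succ_fun]
    have h : ∀ a, ∑ x : Fin m → I, (∏ i, p ((Fin.cons a x : Fin (m + 1) → I) i)) *
        ∑ i, Z ((Fin.cons a x : Fin (m + 1) → I) i) = p a * Z a := fun a => by
      simp only [Fin.prod_univ_succ, Fin.sum_univ_succ, Fin.cons_zero, Fin.cons_succ]
      calc ∑ x : Fin m → I, p a * (∏ i, p (x i)) * (Z a + ∑ i, Z (x i))
          = p a * Z a * (∑ x : Fin m → I, ∏ i, p (x i)) +
            p a * ∑ x : Fin m → I, (∏ i, p (x i)) * ∑ i, Z (x i) := by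
            rw [Finset.mul_sum, Finset.mul_sum, ← Finset.sum_add_distrib]
            exact Finset.sum_congr rfl fun _ _ => by ring
        _ = p a * Z a := by rw [sum_prod_eq_one hp1, ih]; ring
    rw [Finset.sum_congr rfl fun a _ => h a, hZ]

/-- The variance of a sum of independent centred variables. -/
lemma sum_prod_mul_sum_sq {p Z : I → ℝ} (hp1 : ∑ i, p i = 1) (hZ : ∑ i, p i * Z i = 0) (m : ℕ) :
    ∑ x : Fin m → I, (∏ i, p (x i)) * (∑ i, Z (x i)) ^ 2 = m * ∑ i, p i * Z i ^ 2 := by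
  induction m with
  | zero => simp
  | succ m ih =>
    rw [sum_fin_succ_fun]
    have h : ∀ a, ∑ x : Fin m → I, (∏ i, p ((Fin.cons a x : Fin (m + 1) → I) i)) *
        (∑ i, Z ((Fin.cons a x : Fin (m + 1) → I) i)) ^ 2 =
          p a * Z a ^ 2 + p a * (m * ∑ i, p i * Z i ^ 2) := fun a => by
      simp only [Fin.prod_univ_succ, Fin.sum_univ_succ, Fin.cons_zero, Fin.cons_succ]
      calc ∑ x : Fin m → I, p a * (∏ i, p (x i)) * (Z a + ∑ i, Z (x i)) ^ 2
          = p a * Z a ^ 2 * (∑ x : Fin m → I, ∏ i, p (x i)) +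
            2 * p a * Z a * (∑ x : Fin m → I, (∏ i, p (x i)) * ∑ i, Z (x i)) +
            p a * ∑ x : Fin m → I, (∏ i, p (x i)) * (∑ i, Z (x i)) ^ 2 := by
            rw [Finset.mul_sum, Finset.mul_sum, Finset.mul_sum, ← Finset.sum_add_distrib,
              ← Finset.sum_add_distrib]
            exact Finset.sum_congr rfl fun _ _ => by ring
        -- The cross term vanishes because the remaining letters have mean zero.
        _ = _ := by rw [sum_prod_eq_one hp1, sum_prod_mul_sum hp1 hZ, ih]; ring
    rw [Finset.sum_congr rfl fun a _ => h a, Finset.sum_add_distrib, ← Finset.sum_mul, hp1]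
    push_cast
    ring

/-- Chebyshev's inequality for a sum of independent centred variables. -/
lemma sum_filter_prod_le {p Z : I → ℝ} (hp : ∀ i, 0 ≤ p i) (hp1 : ∑ i, p i = 1)
    (hZ : ∑ i, p i * Z i = 0) {m : ℕ} {t : ℝ} (ht : 0 < t) (Q : (Fin m → I) → Prop)
    [DecidablePred Q] (hQ : ∀ x, Q x → ∏ i, p (x i) ≠ 0 → t ≤ |∑ i, Z (x i)|) :
    ∑ x with Q x, ∏ i, p (x i) ≤ m * (∑ i, p i * Z i ^ 2) / t ^ 2 := by
  have h0 : ∀ x : Fin m → I, 0 ≤ ∏ i, p (x i) := fun x => Finset.prod_nonneg fun i _ => hp _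
  rw [← sum_prod_mul_sum_sq hp1 hZ, le_div_iff₀ (by positivity), Finset.sum_mul]
  refine (Finset.sum_le_sum fun x hx => ?_).trans (Finset.sum_le_sum_of_subset_of_nonneg
    (Finset.filter_subset _ _) fun x _ _ => mul_nonneg (h0 x) (sq_nonneg _))
  by_cases hx0 : ∏ i, p (x i) = 0
  · simp [hx0]
  · refine mul_le_mul_of_nonneg_left ?_ (h0 x)
    rw [← sq_abs (∑ i, Z (x i))]
    exact pow_le_pow_left₀ ht.le (hQ x (Finset.mem_filter.1 hx).2 hx0) 2

/-- The Shannon entropy in bits. -/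
noncomputable def shannonEntropy (p : I → ℝ) : ℝ := ∑ i, -(p i * Real.logb 2 (p i))

/-- The variance of the surprisal. -/
noncomputable def varentropy (p : I → ℝ) : ℝ :=
  ∑ i, p i * (Real.logb 2 (p i) + shannonEntropy p) ^ 2

lemma varentropy_nonneg {p : I → ℝ} (hp : ∀ i, 0 ≤ p i) : 0 ≤ varentropy p :=
  Finset.sum_nonneg fun i _ => mul_nonneg (hp i) (sq_nonneg _)

lemma shannonEntropy_nonneg {p : I → ℝ} (hp : ∀ i, 0 ≤ p i) (hp1 : ∑ i, p i = 1) :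
    0 ≤ shannonEntropy p := by
  refine Finset.sum_nonneg fun i _ => neg_nonneg.2 (mul_nonpos_of_nonneg_of_nonpos (hp i) ?_)
  refine Real.logb_nonpos one_lt_two (hp i) ?_
  rw [← hp1]
  exact Finset.single_le_sum (fun i _ => hp i) (Finset.mem_univ i)

lemma sum_mul_logb_add_shannonEntropy {p : I → ℝ} (hp1 : ∑ i, p i = 1) :
    ∑ i, p i * (Real.logb 2 (p i) + shannonEntropy p) = 0 := by
  simp only [mul_add, Finset.sum_add_distrib, ← Finset.sum_mul, hp1, shannonEntropy,
    Finset.sum_neg_distrib]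
  ring

/-- The logarithm of a product splits only over nonzero factors; hence `sum_filter_prod_le` asks for
its deviation bound only on strings of nonzero probability. -/
lemma sum_logb_add_shannonEntropy {p : I → ℝ} {m : ℕ} {x : Fin m → I}
    (hx : ∏ i, p (x i) ≠ 0) :
    ∑ i, (Real.logb 2 (p (x i)) + shannonEntropy p) =
      Real.logb 2 (∏ i, p (x i)) + m * shannonEntropy p := by
  rw [Finset.sum_add_distrib, Real.logb_prod _ _ fun i hi => Finset.prod_ne_zero_iff.1 hx i hi]
  simp

/-- Strings that are much more likely than `2 ^ (-m H)` have a small total probability. -/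
lemma sum_prod_le_of_le {p : I → ℝ} (hp : ∀ i, 0 ≤ p i) (hp1 : ∑ i, p i = 1) {m : ℕ} {t : ℝ}
    (ht : 0 < t) :
    ∑ x : Fin m → I with (2 : ℝ) ^ (-(m * shannonEntropy p) + t) ≤ ∏ i, p (x i), ∏ i, p (x i) ≤
      m * varentropy p / t ^ 2 := by
  refine sum_filter_prod_le hp hp1 (sum_mul_logb_add_shannonEntropy hp1) ht _ fun x hx h0 => ?_
  rw [sum_logb_add_shannonEntropy h0]
  have h := Real.logb_le_logb_of_le one_lt_two (by positivity) hx
  rw [Real.logb_rpow two_pos (by norm_num)] at h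
  exact le_trans (by linarith) (le_abs_self _)

/-- Strings that are much less likely than `2 ^ (-m H)` have a small total probability. -/
lemma sum_prod_le_of_lt {p : I → ℝ} (hp : ∀ i, 0 ≤ p i) (hp1 : ∑ i, p i = 1) {m : ℕ} {t : ℝ}
    (ht : 0 < t) :
    ∑ x : Fin m → I with ∏ i, p (x i) < (2 : ℝ) ^ (-(m * shannonEntropy p) - t), ∏ i, p (x i) ≤
      m * varentropy p / t ^ 2 := by
  refine sum_filter_prod_le hp hp1 (sum_mul_logb_add_shannonEntropy hp1) ht _ fun x hx h0 => ?_
  rw [sum_logb_add_shannonEntropy h0]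
  have h00 : 0 < ∏ i, p (x i) :=
    lt_of_le_of_ne (Finset.prod_nonneg fun i _ => hp _) (Ne.symm h0)
  have h := Real.logb_le_logb_of_le one_lt_two h00 hx.le
  rw [Real.logb_rpow two_pos (by norm_num)] at h
  exact le_trans (by linarith) (neg_le_abs _)

/-- The probability of a string takes polynomially many values only. -/
lemma card_image_prod_le [DecidableEq I] (p : I → ℝ) (m : ℕ) :
    (Finset.univ.image fun x : Fin m → I => ∏ i, p (x i)).card ≤ (m + 1) ^ Fintype.card I := by
  have h : (Finset.univ.image fun x : Fin m → I => ∏ i, p (x i)) ⊆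
      Finset.univ.image fun c : I → Fin (m + 1) => ∏ b, p b ^ (c b : ℕ) := by
    intro v hv
    obtain ⟨x, -, rfl⟩ := Finset.mem_image.1 hv
    -- The product depends only on how often each letter occurs, and each count lies in `0, …, m`.
    have hc : ∀ b, (Finset.univ.filter fun i => x i = b).card < m + 1 := fun b =>
      Nat.lt_succ_of_le ((Finset.card_le_univ _).trans (Fintype.card_fin m).le)
    refine Finset.mem_image.2 ⟨fun b => ⟨_, hc b⟩, Finset.mem_univ _, ?_⟩
    rw [← Finset.prod_fiberwise Finset.univ x fun i => p (x i)]
    refine Finset.prod_congr rfl fun b _ => ?_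
    rw [Finset.prod_congr rfl fun i hi => by rw [(Finset.mem_filter.1 hi).2], Finset.prod_const]
  refine (Finset.card_le_card h).trans (Finset.card_image_le.trans ?_)
  simp

end Typicality

/-! ### Cutting level sets into blocks -/

/-- A finite probability space splits into blocks of a prescribed size on which the probability is
constant and positive, and, for every positive level, fewer remaining points than a block has. -/
lemma exists_blocks {X : Type} [Fintype X] [DecidableEq X] (p : X → ℝ) (Z : Type)
    [Fintype Z] [Nonempty Z] :
    ∃ (J : Type) (_ : Fintype J) (e : J × Z ↪ X),
      (∀ j z z', p (e (j, z)) = p (e (j, z'))) ∧ (∀ y, 0 < p (e y)) ∧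
      ∀ v, 0 < v → (Finset.univ.filter fun x => p x = v ∧ x ∉ Set.range e).card <
        Fintype.card Z := by
  classical
  have hk : 0 < Fintype.card Z := Fintype.card_pos
  obtain ⟨V, hV⟩ : ∃ V : Finset ℝ, ∀ v, v ∈ V ↔ v ∈ Finset.univ.image p ∧ 0 < v :=
    ⟨(Finset.univ.image p).filter fun v => 0 < v, fun v => Finset.mem_filter⟩
  -- As many blocks as fit into the level set; the remainder of this division counts the uncovered
  -- points.
  obtain ⟨q, hq⟩ : ∃ q : ℝ → ℕ, ∀ v, q v = Fintype.card {x // p x = v} / Fintype.card Z :=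
    ⟨_, fun _ => rfl⟩
  have hemb : ∀ v, Nonempty (Fin (q v) × Z ↪ {x // p x = v}) := fun v => by
    refine Function.Embedding.nonempty_of_card_le ?_
    rw [Fintype.card_prod, Fintype.card_fin, hq]
    exact Nat.div_mul_le_self _ _
  have f : ∀ v, Fin (q v) × Z ↪ {x // p x = v} := fun v => (hemb v).some
  have hinj : Function.Injective fun y : (Σ v : {v // v ∈ V}, Fin (q v)) × Z =>
      ((f y.1.1 (y.1.2, y.2) : {x // p x = y.1.1}) : X) := by
    rintro ⟨⟨v, i⟩, z⟩ ⟨⟨w, j⟩, z'⟩ h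
    have hvw : v = w := Subtype.ext (by
      rw [← (f v (i, z)).2, ← (f w (j, z')).2]
      exact congrArg p h)
    subst hvw
    have h1 := (f v).injective (Subtype.ext h)
    simp only [Prod.mk.injEq] at h1
    rw [h1.1, h1.2]
  refine ⟨Σ v : {v // v ∈ V}, Fin (q v), Sigma.instFintype, ⟨_, hinj⟩, ?_, ?_, ?_⟩
  · rintro ⟨v, i⟩ z z'
    exact (f v (i, z)).2.trans (f v (i, z')).2.symm
  · rintro ⟨⟨v, i⟩, z⟩
    exact lt_of_lt_of_eq ((hV v).1 v.2).2 (f v (i, z)).2.symm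
  · intro v hv
    by_cases hvp : v ∈ Finset.univ.image p
    · have hvW : v ∈ V :=
        (hV v).2 ⟨hvp, hv⟩
      let F := Finset.univ.filter fun x => p x = v
      let R := Finset.univ.image fun y : Fin (q v) × Z => ((f v y : {x // p x = v}) : X)
      have hRcard : R.card = q v * Fintype.card Z := by
        refine (Finset.card_image_of_injective _
          (Subtype.val_injective.comp (f v).injective)).trans ?_
        simp
      have hRF : R ⊆ F := fun x hx => by
        obtain ⟨y, -, rfl⟩ := Finset.mem_image.1 hx
        exact Finset.mem_filter.2 ⟨Finset.mem_univ _, (f v y).2⟩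
      have hF : F.card = Fintype.card {x // p x = v} := (Fintype.card_subtype _).symm
      have hsub : (Finset.univ.filter fun x => p x = v ∧ x ∉ Set.range
          fun y : (Σ v : {v // v ∈ V}, Fin (q v)) × Z =>
            ((f y.1.1 (y.1.2, y.2) : {x // p x = y.1.1}) : X)) ⊆ F \ R := by
        intro x hx
        obtain ⟨-, hx1, hx2⟩ := Finset.mem_filter.1 hx
        refine Finset.mem_sdiff.2 ⟨Finset.mem_filter.2 ⟨Finset.mem_univ _, hx1⟩, fun hxR => hx2 ?_⟩
        obtain ⟨y, -, rfl⟩ := Finset.mem_image.1 hxR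
        exact ⟨(⟨⟨v, hvW⟩, y.1⟩, y.2), rfl⟩
      refine (Finset.card_le_card hsub).trans_lt ?_
      rw [Finset.card_sdiff_of_subset hRF, hRcard, hF, Nat.mul_comm]
      have := Nat.mod_lt (Fintype.card {x // p x = v}) hk
      have h2 := Nat.mod_add_div (Fintype.card {x // p x = v}) (Fintype.card Z)
      rw [hq]
      omega
    · rw [Finset.filter_false_of_mem, Finset.card_empty]
      · exact hk
      · exact fun x _ h => hvp (Finset.mem_image.2 ⟨x, Finset.mem_univ _, h.1⟩)

/-- The total probability of the points outside the blocks of `exists_blocks`. -/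
lemma sum_remainder_le {X : Type} [Fintype X] {p : X → ℝ} (hp : ∀ x, 0 ≤ p x)
    (R : X → Prop) [DecidablePred R] {k : ℕ}
    (hR : ∀ v, 0 < v → (Finset.univ.filter fun x => p x = v ∧ R x).card < k) {τ : ℝ}
    (hτ : 0 ≤ τ) :
    ∑ x with R x, p x ≤
      (∑ x with τ ≤ p x, p x) + (Finset.univ.image p).card * ((k - 1 : ℕ) * τ) := by
  classical
  -- All points of weight at least `τ` are given up; the others are counted level by level.
  have h1 : ∑ x with R x, p x ≤ (∑ x with τ ≤ p x, p x) + ∑ x with R x ∧ p x < τ, p x := by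
    rw [← Finset.sum_filter_add_sum_filter_not (Finset.univ.filter R) fun x => τ ≤ p x,
      Finset.filter_filter, Finset.filter_filter]
    simp only [not_le]
    gcongr
    · exact fun x _ _ => hp x
    · exact And.right
  refine h1.trans (add_le_add le_rfl ?_)
  rw [← Finset.sum_fiberwise_of_maps_to (t := Finset.univ.image p) (g := p)
    fun x _ => Finset.mem_image_of_mem p (Finset.mem_univ x), ← nsmul_eq_mul]
  refine Finset.sum_le_card_nsmul _ _ _ fun v _ => ?_
  rw [Finset.filter_filter, Finset.sum_congr rfl fun x hx => (Finset.mem_filter.1 hx).2.2,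
    Finset.sum_const, nsmul_eq_mul]
  rcases (Finset.univ.filter fun x => (R x ∧ p x < τ) ∧ p x = v).eq_empty_or_nonempty with
    he | ⟨x, hx⟩
  · rw [he, Finset.card_empty, Nat.cast_zero, zero_mul]
    positivity
  · obtain ⟨⟨-, hxτ⟩, rfl⟩ := (Finset.mem_filter.1 hx).2
    -- Level 0 may keep arbitrarily many points, but they carry no weight.
    rcases (hp x).eq_or_lt with h0 | h0
    · rw [← h0, mul_zero]
      positivity
    · have hlt := hR (p x) h0
      have hle : (Finset.univ.filter fun y => (R y ∧ p y < τ) ∧ p y = p x).card ≤ k - 1 := by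
        refine Nat.le_sub_one_of_lt (lt_of_le_of_lt (Finset.card_le_card ?_) hlt)
        exact Finset.monotone_filter_right _ fun y _ hy => ⟨hy.2, hy.1.1⟩
      gcongr

/-! ### Protocols for entanglement concentration -/

/-- Some LOCC map sends the vector with coefficient matrix `M` to `ρ`. -/
def LOCCReaches {X Y A' B' : Type} [Fintype X] [Fintype Y] [DecidableEq X] [DecidableEq Y]
    [Fintype A'] [Fintype B'] [DecidableEq A'] [DecidableEq B'] (M : Matrix X Y ℂ)
    (ρ : BipartiteOp A' B') : Prop :=
  ∃ T : BipartiteOp X Y → BipartiteOp A' B', IsLOCC T ∧ T (vecProj M) = ρ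

section

variable {X Y C A' B' J : Type} [Fintype X] [Fintype Y] [Fintype C] [Fintype J] [DecidableEq X]
  [DecidableEq Y] [DecidableEq C] [Fintype A'] [Fintype B'] [DecidableEq A'] [DecidableEq B']

lemma LOCCReaches.alice {M : Matrix X Y ℂ} (K : J → Matrix C X ℂ) (hK : ∑ j, (K j)ᴴ * K j = 1)
    {ρ : J → BipartiteOp A' B'} (h : ∀ j, LOCCReaches (K j * M) (ρ j)) :
    LOCCReaches M (∑ j, ρ j) := by
  choose T hT hTρ using h
  refine ⟨_, .alice K hK T hT, Finset.sum_congr rfl fun j _ => ?_⟩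
  rw [kronecker_mul_vecProj, transpose_one, Matrix.mul_one, hTρ]

lemma LOCCReaches.bob {M : Matrix X Y ℂ} (K : J → Matrix C Y ℂ) (hK : ∑ j, (K j)ᴴ * K j = 1)
    {ρ : J → BipartiteOp A' B'} (h : ∀ j, LOCCReaches (M * (K j)ᵀ) (ρ j)) :
    LOCCReaches M (∑ j, ρ j) := by
  choose T hT hTρ using h
  refine ⟨_, .bob K hK T hT, Finset.sum_congr rfl fun j _ => ?_⟩
  rw [kronecker_mul_vecProj, Matrix.one_mul, hTρ]

end

lemma sum_single_self {Y : Type} [Fintype Y] [DecidableEq Y] :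
    ∑ y : Y, Matrix.single y y (1 : ℂ) = 1 := by
  ext i j
  simp [Matrix.sum_apply, Matrix.single_apply, Matrix.one_apply, ite_and]

lemma sum_single_conjTranspose_mul {Y Z : Type} [Fintype Y] [Fintype Z] [DecidableEq Y]
    [DecidableEq Z] (z : Z) :
    ∑ y : Y, (Matrix.single z y (1 : ℂ))ᴴ * Matrix.single z y (1 : ℂ) = 1 := by
  simp only [conjTranspose_single, single_mul_single_same, star_one, mul_one, sum_single_self]

/-- Bob can bring his system into a fixed pure state. -/
lemma exists_LOCCReaches_posSemidef {X Y Z : Type} [Fintype X] [Fintype Y] [Fintype Z]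
    [DecidableEq X] [DecidableEq Y] [DecidableEq Z] [Nonempty Z] (M : Matrix X Y ℂ) :
    ∃ ρ : BipartiteOp X Z, LOCCReaches M ρ ∧ ρ.PosSemidef ∧ ρ.trace = (sqNorm M : ℂ) := by
  obtain ⟨z⟩ := ‹Nonempty Z›
  refine ⟨_, LOCCReaches.bob _ (sum_single_conjTranspose_mul z) fun y => ⟨_, .done, rfl⟩,
    posSemidef_sum _ fun y _ => vecProj_posSemidef _, ?_⟩
  rw [Matrix.trace_sum, sqNorm, Finset.sum_comm, Complex.ofReal_sum]
  refine Finset.sum_congr rfl fun y _ => ?_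
  rw [trace_vecProj]
  congr 1
  refine Finset.sum_congr rfl fun x _ => ?_
  rw [Finset.sum_eq_single z (fun w _ hw => ?_) (by simp)]
  · simp [Matrix.mul_apply, Matrix.single_apply]
  · simp [Matrix.mul_apply, Ne.symm hw]

/-- A vector with flat Schmidt coefficients is locally equivalent to the maximally entangled
one. -/
lemma LOCCReaches_maxState {Y Z : Type} [Fintype Y] [Fintype Z]
    [DecidableEq Y] [DecidableEq Z] [Nonempty Z] {G : Matrix Z Y ℂ} {c : ℝ} (hc : 0 < c)
    (hG : G * Gᴴ = (c : ℂ) • (1 : Matrix Z Z ℂ)) :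
    LOCCReaches G (((c * Fintype.card Z : ℝ) : ℂ) • maxState Z) := by
  have hk : (0 : ℝ) < Fintype.card Z := by exact_mod_cast Fintype.card_pos
  have hcC : (c : ℂ) ≠ 0 := by exact_mod_cast hc.ne'
  have hs : ((√c : ℝ) : ℂ) * (√c : ℝ) = c := by
    rw [← Complex.ofReal_mul, Real.mul_self_sqrt hc.le]
  have hs0 : ((√c : ℝ) : ℂ) ≠ 0 := by exact_mod_cast (Real.sqrt_pos.2 hc).ne'
  -- Flatness of `G` makes `Q` an isometry, and Bob's operator `Qᵀ` turns `G` into `G Q = √c • 1`.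
  set Q : Matrix Y Z ℂ := ((√c : ℝ) : ℂ)⁻¹ • Gᴴ with hQ
  have hGQ : G * Q = ((√c : ℝ) : ℂ) • (1 : Matrix Z Z ℂ) := by
    rw [hQ, Matrix.mul_smul, hG, smul_smul, ← hs, inv_mul_cancel_left₀ hs0]
  have hQH : Qᴴ = ((√c : ℝ) : ℂ)⁻¹ • G := by
    rw [hQ, conjTranspose_smul, conjTranspose_conjTranspose, star_inv₀, Complex.star_def,
      Complex.conj_ofReal]
  have hQQ : Qᴴ * Q = 1 := by
    rw [hQH, Matrix.smul_mul, hGQ, smul_smul, inv_mul_cancel₀ hs0, one_smul]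
  have hGP : G * (1 - Q * Qᴴ) = 0 := by
    rw [Matrix.mul_sub, ← Matrix.mul_assoc, hGQ, Matrix.smul_mul, Matrix.one_mul, hQH, smul_smul,
      mul_inv_cancel₀ hs0, one_smul, Matrix.mul_one, sub_self]
  have hPP : (1 - Q * Qᴴ) * (1 - Q * Qᴴ) = 1 - Q * Qᴴ := by
    rw [Matrix.mul_sub, Matrix.mul_one, Matrix.sub_mul, Matrix.one_mul, Matrix.mul_assoc,
      ← Matrix.mul_assoc Qᴴ, hQQ, Matrix.one_mul, sub_self, sub_zero]
  have hPH : (1 - Q * Qᴴ)ᴴ = 1 - Q * Qᴴ := by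
    rw [conjTranspose_sub, conjTranspose_one, conjTranspose_mul, conjTranspose_conjTranspose]
  obtain ⟨z⟩ := ‹Nonempty Z›
  -- The outcomes `some y` only complete the measurement: they see the complement of the range of
  -- `Q`, where `G` vanishes, so they have probability zero.
  let K : Option Y → Matrix Z Y ℂ := fun o =>
    o.elim Qᵀ fun y => Matrix.single z y (1 : ℂ) * (1 - Q * Qᴴ)ᵀ
  have hK : ∑ o, (K o)ᴴ * K o = 1 := by
    have h1 : ∀ y : Y, (Matrix.single z y (1 : ℂ) * (1 - Q * Qᴴ)ᵀ)ᴴ *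
        (Matrix.single z y (1 : ℂ) * (1 - Q * Qᴴ)ᵀ) = ((1 - Q * Qᴴ)ᵀ)ᴴ *
          ((Matrix.single z y (1 : ℂ))ᴴ * Matrix.single z y (1 : ℂ)) * (1 - Q * Qᴴ)ᵀ := fun y => by
      rw [conjTranspose_mul]
      simp only [Matrix.mul_assoc]
    have h2 : ((1 - Q * Qᴴ)ᵀ)ᴴ = (1 - Q * Qᴴ)ᵀ := by
      change ((1 - Q * Qᴴ)ᴴ)ᵀ = _
      rw [hPH]
    have h3 : (Qᵀ)ᴴ = (Qᴴ)ᵀ := rfl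
    rw [Fintype.sum_option]
    simp only [K, Option.elim_none, Option.elim_some, h1]
    rw [← Matrix.sum_mul, ← Matrix.mul_sum, sum_single_conjTranspose_mul, Matrix.mul_one, h2,
      ← transpose_mul, hPP, h3, ← transpose_mul, ← transpose_add,
      add_sub_cancel, transpose_one]
  have hsum : ∑ o : Option Y, vecProj (G * (K o)ᵀ) =
      ((c * Fintype.card Z : ℝ) : ℂ) • maxState Z := by
    rw [Fintype.sum_option, Finset.sum_eq_zero fun y _ => ?_, add_zero]
    · simp only [K, Option.elim_none, transpose_transpose]
      rw [hGQ, maxState, vecProj_smul, vecProj_smul, smul_smul, ← Complex.ofReal_mul,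
        ← Complex.ofReal_inv, Complex.norm_real, Complex.norm_real, Real.norm_eq_abs,
        Real.norm_eq_abs, sq_abs, sq_abs, inv_pow, Real.sq_sqrt hc.le, Real.sq_sqrt hk.le,
        mul_assoc, mul_inv_cancel₀ hk.ne', mul_one]
    · simp only [K, Option.elim_some, transpose_mul, transpose_transpose]
      rw [← Matrix.mul_assoc, hGP, Matrix.zero_mul, vecProj_zero]
  rw [← hsum]
  exact LOCCReaches.bob K hK fun o => ⟨_, .done, rfl⟩

lemma sum_embedding_add_sum_compl {X W E : Type} [Fintype X] [Fintype W] [AddCommMonoid E]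
    (e : W ↪ X) [DecidablePred fun x => x ∉ Set.range e] (f : X → E) :
    ∑ w, f (e w) + ∑ r : {x // x ∉ Set.range e}, f r = ∑ x, f x := by
  classical
  rw [← Fintype.sum_subtype_add_sum_subtype (fun x => x ∈ Set.range e) f]
  congr 1
  · convert (Equiv.ofInjective e e.injective).sum_comp fun x => f x
    rfl
  · convert rfl

/-- Entanglement concentration: if the squared Schmidt coefficients are constant on blocks, the
maximally entangled state of the size of the blocks is obtained up to the weight of the rest. -/
lemma exists_LOCC_traceNorm_le {X Y Z J : Type} [Fintype X] [Fintype Y] [Fintype Z] [Fintype J]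
    [DecidableEq X] [DecidableEq Y] [DecidableEq Z] [Nonempty Z] {M : Matrix X Y ℂ} {p : X → ℝ}
    (hM : M * Mᴴ = diagonal fun x => (p x : ℂ)) (hp1 : ∑ x, p x = 1)
    (e : J × Z ↪ X) [DecidablePred fun x => x ∉ Set.range e]
    (he : ∀ j z z', p (e (j, z)) = p (e (j, z'))) (he0 : ∀ y, 0 < p (e y)) :
    ∃ ρ : BipartiteOp Z Z, LOCCReaches M ρ ∧
      traceNorm (ρ - maxState Z) ≤ 2 * ∑ x with x ∉ Set.range e, p x := by
  let z0 : Z := Classical.arbitrary Z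
  -- Alice finds a block, which she relabels by `Z`, or a single leftover index, which she sends to
  -- an arbitrary `z0`.
  let K : J ⊕ {x // x ∉ Set.range e} → Matrix Z X ℂ := fun o =>
    o.elim (fun j => (1 : Matrix X X ℂ).submatrix (fun z => e (j, z)) id)
      fun r => Matrix.single z0 r.1 1
  have hK : ∑ o, (K o)ᴴ * K o = 1 := by
    have h1 : ∀ j, (K (.inl j))ᴴ * K (.inl j) = ∑ z, Matrix.single (e (j, z)) (e (j, z)) 1 := by
      intro j
      ext x y
      rw [Matrix.mul_apply, Matrix.sum_apply]
      refine Finset.sum_congr rfl fun z _ => ?_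
      simp only [K, Sum.elim_inl, conjTranspose_apply, submatrix_apply, Matrix.one_apply, id_eq,
        Matrix.single_apply, ite_and]
      split_ifs <;> simp
    have h2 : ∀ r : {x // x ∉ Set.range e}, (K (.inr r))ᴴ * K (.inr r) =
        Matrix.single r.1 r.1 1 := by
      intro r
      simp [K, conjTranspose_single, single_mul_single_same]
    rw [Fintype.sum_sum_type]
    simp only [h1, h2]
    rw [← Fintype.sum_prod_type fun w => Matrix.single (e w) (e w) (1 : ℂ),
      sum_embedding_add_sum_compl e fun x => Matrix.single x x (1 : ℂ),
      sum_single_self]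
  have hblock : ∀ j, LOCCReaches (K (.inl j) * M)
      (((p (e (j, z0)) * Fintype.card Z : ℝ) : ℂ) • maxState Z) := by
    intro j
    refine LOCCReaches_maxState (he0 _) ?_
    have h1 : K (.inl j) * M = M.submatrix (fun z => e (j, z)) id := by
      ext z y
      simp [K, Matrix.mul_apply, Matrix.one_apply]
    have h2 : (M.submatrix (fun z => e (j, z)) id) * (M.submatrix (fun z => e (j, z)) id)ᴴ =
        (M * Mᴴ).submatrix (fun z => e (j, z)) fun z => e (j, z) := by
      ext z z'
      simp [Matrix.mul_apply]
    rw [h1, h2, hM, smul_one_eq_diagonal]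
    ext z z'
    simp only [submatrix_apply, diagonal_apply, EmbeddingLike.apply_eq_iff_eq, Prod.mk.injEq,
      true_and, he j z z0]
  have hfail : ∀ r : {x // x ∉ Set.range e}, ∃ ρ : BipartiteOp Z Z,
      LOCCReaches (K (.inr r) * M) ρ ∧ ρ.PosSemidef ∧ ρ.trace = (p r : ℂ) := by
    intro r
    obtain ⟨ρ, h1, h2, h3⟩ := exists_LOCCReaches_posSemidef (Z := Z) (K (.inr r) * M)
    refine ⟨ρ, h1, h2, h3.trans ?_⟩
    have h4 := mul_conjTranspose_self_apply_self M r.1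
    rw [hM, diagonal_apply_eq] at h4
    rw [h4, sqNorm, Finset.sum_eq_single z0 (fun w _ hw => ?_) (by simp)]
    · simp [K, Matrix.mul_apply, Matrix.single_apply]
    · simp [K, Matrix.mul_apply, Ne.symm hw]
  choose σ hσ hσ0 hσtr using hfail
  have hreach := LOCCReaches.alice K hK
    (ρ := fun o => o.elim (fun j => ((p (e (j, z0)) * Fintype.card Z : ℝ) : ℂ) • maxState Z) σ)
    (M := M) (by rintro (j | r); exacts [hblock j, hσ r])
  refine ⟨_, hreach, ?_⟩
  set ε : ℝ := ∑ x with x ∉ Set.range e, p x with hε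
  have hεr : ∑ r : {x // x ∉ Set.range e}, p r = ε :=
    (Finset.sum_subtype _ (by simp) p).symm
  have hε0 : 0 ≤ ε := by
    rw [← hεr]
    refine Finset.sum_nonneg fun r _ => ?_
    exact_mod_cast hσtr r ▸ (hσ0 r).trace_nonneg
  have hsum : ∑ j, p (e (j, z0)) * Fintype.card Z = 1 - ε := by
    have h1 := sum_embedding_add_sum_compl e p
    rw [hεr, hp1, Fintype.sum_prod_type] at h1
    rw [← h1, add_sub_cancel_right]
    refine Finset.sum_congr rfl fun j _ => ?_
    rw [Finset.sum_congr rfl fun z _ => he j z z0]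
    simp [mul_comm]
  -- The blocks give the target with weight `1 - ε`. What remains is a positive operator of trace
  -- `ε` minus `ε` times the target, whence the factor 2.
  have hout : (∑ o : J ⊕ {x // x ∉ Set.range e}, (o.elim
      (fun j => ((p (e (j, z0)) * Fintype.card Z : ℝ) : ℂ) • maxState Z) σ : BipartiteOp Z Z)) -
        maxState Z = (∑ r, σ r) - (ε : ℂ) • maxState Z := by
    rw [Fintype.sum_sum_type]
    simp only [Sum.elim_inl, Sum.elim_inr]
    rw [← Finset.sum_smul, ← Complex.ofReal_sum, hsum, Complex.ofReal_sub, Complex.ofReal_one,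
      sub_smul, one_smul]
    abel
  rw [hout]
  refine (traceNorm_sub_le (posSemidef_sum _ fun r _ => hσ0 r)
    ((vecProj_posSemidef _).smul (Complex.zero_le_real.2 hε0))).trans (le_of_eq ?_)
  rw [Matrix.trace_sum, Finset.sum_congr rfl fun r _ => hσtr r, ← Complex.ofReal_sum, hεr]
  change (ε : ℂ).re + ((ε : ℂ) • maxState Z).trace.re = _
  rw [Matrix.trace_smul, trace_maxState, smul_eq_mul, mul_one, Complex.ofReal_re]
  ring

/-! ### Schmidt decomposition and finite-`m` bounds -/

/-- The Schmidt decomposition of a pure state, with a basis change on the first system only. -/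
lemma IsPureState.exists_schmidt {A B : Type} [Fintype A] [Fintype B] [DecidableEq A]
    [DecidableEq B] {φ : BipartiteOp A B} (hφ : IsPureState φ) :
    ∃ (U : Matrix A A ℂ) (M : Matrix A B ℂ) (p : A → ℝ), Uᴴ * U = 1 ∧ U * Uᴴ = 1 ∧
      φ = vecProj (U * M) ∧ (M * Mᴴ = diagonal fun a => (p a : ℂ)) ∧ (∀ a, 0 ≤ p a) ∧
      ∑ a, p a = 1 ∧ vonNeumannEntropy (partialTraceB φ) = shannonEntropy p ∧
      vonNeumannEntropy (partialTraceB φ) = vonNeumannEntropy (partialTraceA φ) := by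
  obtain ⟨ψ, hψ, rfl⟩ := hφ
  set G : Matrix A B ℂ := Matrix.of fun a b => ψ (a, b) with hG
  have hφ : vecMulVec ψ (star ψ) = vecProj G := rfl
  have hGn : sqNorm G = 1 := by
    rw [← hψ, Fintype.sum_prod_type]
    rfl
  have hA : (G * Gᴴ).IsHermitian := isHermitian_mul_conjTranspose_self G
  obtain ⟨U, hU, hU', h⟩ := exists_unitary_conj_eq_diagonal hA
  -- The rows of `Uᴴ * G` are orthogonal. Bob's basis need not be changed: his isometry in
  -- `LOCCReaches_maxState` absorbs it.
  refine ⟨U, Uᴴ * G, hA.eigenvalues, hU, hU', ?_, ?_, ?_, ?_, ?_, ?_⟩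
  · rw [← Matrix.mul_assoc, hU', Matrix.one_mul, hφ]
  · rw [conjTranspose_mul, conjTranspose_conjTranspose, ← Matrix.mul_assoc, Matrix.mul_assoc Uᴴ]
    generalize hA.eigenvalues = lam at h
    rw [h, Matrix.mul_assoc, Matrix.mul_assoc, hU, Matrix.mul_one, ← Matrix.mul_assoc, hU,
      Matrix.one_mul]
  · exact (posSemidef_self_mul_conjTranspose G).eigenvalues_nonneg
  · have h1 := hA.trace_eq_sum_eigenvalues
    rw [← sqNorm_eq_trace, hGn] at h1
    refine Complex.ofReal_injective (Eq.trans ?_ h1.symm)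
    exact Complex.ofReal_sum _ _
  · rw [hφ, partialTraceB_vecProj, vonNeumannEntropy_eq_sum_eigenvalues hA, shannonEntropy]
  · rw [hφ, partialTraceB_vecProj, partialTraceA_vecProj, vonNeumannEntropy_mul_conjTranspose]

lemma matrixPower_mul_conjTranspose {A B : Type} [Fintype A] [Fintype B] [DecidableEq A]
    [DecidableEq B] {M : Matrix A B ℂ} {p : A → ℝ} (hM : M * Mᴴ = diagonal fun a => (p a : ℂ))
    (m : ℕ) : matrixPower M m * (matrixPower M m)ᴴ =
      diagonal fun x => ((∏ i, p (x i) : ℝ) : ℂ) := by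
  rw [← matrixPower_conjTranspose, ← matrixPower_mul, hM, matrixPower_diagonal]
  simp only [Complex.ofReal_prod]

section

variable {A B : Type} [Fintype A] [Fintype B] [DecidableEq A] [DecidableEq B]
  {U : Matrix A A ℂ} {M : Matrix A B ℂ} {p : A → ℝ}

/-- Entanglement concentration for `m` copies, with an explicit error. -/
lemma exists_LOCC_tensorPower (hU : Uᴴ * U = 1) (hU' : U * Uᴴ = 1)
    (hM : M * Mᴴ = diagonal fun a => (p a : ℂ)) (hp : ∀ a, 0 ≤ p a) (hp1 : ∑ a, p a = 1)
    {N : ℕ} (hN : N ≠ 0) (m n : ℕ) {t : ℝ} (ht : 0 < t) :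
    ∃ T : BipartiteOp (Fin m → A) (Fin m → B) → BipartiteOp (Fin n → Fin N) (Fin n → Fin N),
      IsLOCC T ∧
      traceNorm (T (tensorPower (vecProj (U * M)) m) - tensorPower (maxEntangled N) n) ≤
        2 * (m * varentropy p / t ^ 2 + (m + 1) ^ Fintype.card A *
          ((N ^ n - 1 : ℕ) * (2 : ℝ) ^ (-(m * shannonEntropy p) + t))) := by
  classical
  have : NeZero N := ⟨hN⟩
  have hpm : ∀ x : Fin m → A, 0 ≤ ∏ i, p (x i) := fun x => Finset.prod_nonneg fun i _ => hp _
  obtain ⟨J, _, e, he, he0, hcard⟩ := exists_blocks (fun x : Fin m → A => ∏ i, p (x i))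
    (Fin n → Fin N)
  obtain ⟨ρ, hρ, hle⟩ := exists_LOCC_traceNorm_le (matrixPower_mul_conjTranspose hM m)
    (sum_prod_eq_one hp1 m) e he he0
  have hUm : matrixPower Uᴴ m * matrixPower U m = 1 := by
    rw [← matrixPower_mul, hU, matrixPower_one]
  have hUm' : (matrixPower Uᴴ m)ᴴ * matrixPower Uᴴ m = 1 := by
    rw [← matrixPower_conjTranspose, conjTranspose_conjTranspose, ← matrixPower_mul, hU',
      matrixPower_one]
  -- A measurement with one outcome: Alice undoes `U` on every copy.
  have hρ' : LOCCReaches (matrixPower (U * M) m) (∑ _j : Unit, ρ) := by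
    refine LOCCReaches.alice (fun _ => matrixPower Uᴴ m) ?_ fun _ => ?_
    · rw [Fintype.sum_unique, hUm']
    · rwa [matrixPower_mul, ← Matrix.mul_assoc, hUm, Matrix.one_mul]
  obtain ⟨T, hT, hTρ⟩ := hρ'
  refine ⟨T, hT, ?_⟩
  rw [tensorPower_vecProj, tensorPower_maxEntangled, hTρ, Fintype.sum_unique]
  refine hle.trans (mul_le_mul_of_nonneg_left ?_ two_pos.le)
  refine (sum_remainder_le hpm _ hcard (τ := (2 : ℝ) ^ (-(m * shannonEntropy p) + t))
    (by positivity)).trans (add_le_add (sum_prod_le_of_le hp hp1 ht) ?_)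
  have h1 := card_image_prod_le p m
  have h2 : ((Finset.univ.image fun x : Fin m → A => ∏ i, p (x i)).card : ℝ) ≤
      (m + 1) ^ Fintype.card A := by exact_mod_cast h1
  rw [Fintype.card_fun, Fintype.card_fin, Fintype.card_fin]
  gcongr

lemma sqNorm_diagonal_mul {X Y : Type} [Fintype X] [Fintype Y] [DecidableEq X]
    {M : Matrix X Y ℂ} {p : X → ℝ} (hM : M * Mᴴ = diagonal fun x => (p x : ℂ))
    (Q : X → Prop) [DecidablePred Q] :
    sqNorm (diagonal (fun x => if Q x then (1 : ℂ) else 0) * M) = ∑ x with Q x, p x := by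
  rw [Finset.sum_filter, sqNorm]
  refine Finset.sum_congr rfl fun x _ => ?_
  have h := mul_conjTranspose_self_apply_self M x
  rw [hM, diagonal_apply_eq] at h
  rw [Complex.ofReal_injective h]
  simp only [diagonal_mul]
  split_ifs <;> simp

/-- A lower bound for the error of an LOCC map that produces `n` maximally entangled states. -/
lemma one_sub_traceNorm_tensorPower_le (hU : Uᴴ * U = 1)
    (hM : M * Mᴴ = diagonal fun a => (p a : ℂ)) (hp : ∀ a, 0 ≤ p a) (hp1 : ∑ a, p a = 1)
    {N : ℕ} (hN : N ≠ 0) {m n : ℕ} {t : ℝ} (ht : 0 < t)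
    {T : BipartiteOp (Fin m → A) (Fin m → B) → BipartiteOp (Fin n → Fin N) (Fin n → Fin N)}
    (hT : IsLOCC T) :
    1 - traceNorm (T (tensorPower (vecProj (U * M)) m) - tensorPower (maxEntangled N) n) ≤
      2 * ((2 : ℝ) ^ (m * shannonEntropy p + t) / (N : ℝ) ^ n) +
        2 * (m * varentropy p / t ^ 2) := by
  classical
  have : NeZero N := ⟨hN⟩
  have hpm : ∀ x : Fin m → A, 0 ≤ ∏ i, p (x i) := fun x => Finset.prod_nonneg fun i _ => hp _
  set τ : ℝ := (2 : ℝ) ^ (-(m * shannonEntropy p) - t) with hτ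
  have hτ0 : 0 < τ := by positivity
  set D : ((Fin m → A) → Prop) → Matrix (Fin m → A) (Fin m → A) ℂ := fun Q =>
    diagonal fun x => if Q x then (1 : ℂ) else 0 with hD
  set Q : (Fin m → A) → Prop := fun x => ∏ i, p (x i) < τ with hQ
  have hDD : D (fun x => ¬ Q x) + D Q = 1 := by
    simp only [hD]
    rw [diagonal_add, ← diagonal_one]
    congr 1
    ext x
    by_cases h : Q x <;> simp [h]
  -- Keeping the rows of likely strings gives the part of small rank; the rows of unlikely strings
  -- form the small vector.
  have hsplit : matrixPower (U * M) m =
      matrixPower U m * (D (fun x => ¬ Q x) * matrixPower M m) +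
        matrixPower U m * (D Q * matrixPower M m) := by
    rw [← Matrix.mul_add, ← Matrix.add_mul, hDD, Matrix.one_mul, matrixPower_mul]
  have hUm : (matrixPower U m)ᴴ * matrixPower U m = 1 := by
    rw [← matrixPower_conjTranspose, ← matrixPower_mul, hU, matrixPower_one]
  have hMm := matrixPower_mul_conjTranspose hM m
  have hDM : ∀ Q, sqNorm (matrixPower U m * (D Q * matrixPower M m)) =
      ∑ x with Q x, ∏ i, p (x i) := fun Q => by
    rw [sqNorm_unitary_mul hUm]
    exact sqNorm_diagonal_mul hMm Q
  have h1 : sqNorm (matrixPower U m * (D (fun x => ¬ Q x) * matrixPower M m)) ≤ 1 := by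
    rw [hDM, ← sum_prod_eq_one hp1 m]
    exact Finset.sum_le_sum_of_subset_of_nonneg (Finset.subset_univ _) fun x _ _ => hpm x
  have h2 : sqNorm (matrixPower U m * (D Q * matrixPower M m)) ≤
      m * varentropy p / t ^ 2 := by
    rw [hDM]
    convert sum_prod_le_of_lt hp hp1 ht
  have h3 : ((matrixPower U m * (D (fun x => ¬ Q x) * matrixPower M m)).rank : ℝ) ≤
      (2 : ℝ) ^ (m * shannonEntropy p + t) := by
    have hr : (matrixPower U m * (D (fun x => ¬ Q x) * matrixPower M m)).rank ≤
        (Finset.univ.filter fun x => ¬ Q x).card := by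
      refine ((rank_mul_le_right _ _).trans (rank_mul_le_left _ _)).trans (le_of_eq ?_)
      rw [hD, rank_diagonal, Fintype.card_subtype]
      congr 1
      ext x
      simp
    -- At most `1 / τ` strings can have probability at least `τ`.
    have hc : ((Finset.univ.filter fun x => ¬ Q x).card : ℝ) * τ ≤ 1 := by
      rw [← nsmul_eq_mul, ← sum_prod_eq_one hp1 m]
      refine (Finset.card_nsmul_le_sum _ (fun x => ∏ i, p (x i)) _ fun x hx => ?_).trans
        (Finset.sum_le_sum_of_subset_of_nonneg (Finset.filter_subset _ _) fun x _ _ => hpm x)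
      exact not_lt.1 (Finset.mem_filter.1 hx).2
    have hτi : (2 : ℝ) ^ (m * shannonEntropy p + t) = τ⁻¹ := by
      rw [hτ, ← Real.rpow_neg two_pos.le]
      congr 1
      ring
    rw [hτi, ← one_div, le_div_iff₀ hτ0]
    refine le_trans ?_ hc
    gcongr
  have hmain := hT.one_sub_traceNorm_le
    (matrixPower U m * (D (fun x => ¬ Q x) * matrixPower M m))
    (matrixPower U m * (D Q * matrixPower M m))
  rw [← hsplit, ← tensorPower_vecProj, ← tensorPower_maxEntangled, Fintype.card_fun,
    Fintype.card_fin, Fintype.card_fin, Nat.cast_pow] at hmain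
  refine hmain.trans (add_le_add ?_ (mul_le_mul_of_nonneg_left h2 two_pos.le))
  have h0 := sqNorm_nonneg (matrixPower U m * (D (fun x => ¬ Q x) * matrixPower M m))
  calc _ ≤ 2 * ((2 : ℝ) ^ (m * shannonEntropy p + t) / (N : ℝ) ^ n) * 1 := by gcongr
    _ = _ := mul_one _

end

/-! ### Choice of the number of pairs and limits -/

section Asymptotics

lemma one_le_logb_two {N : ℕ} (hN : 2 ≤ N) : 1 ≤ Real.logb 2 N := by
  rw [Real.le_logb_iff_rpow_le one_lt_two (by positivity), Real.rpow_one]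
  exact_mod_cast hN

lemma two_rpow_mul_logb {N : ℕ} (hN : 2 ≤ N) (n : ℕ) :
    (2 : ℝ) ^ (n * Real.logb 2 N) = (N : ℝ) ^ n := by
  have : (0 : ℝ) < N := by positivity
  rw [mul_comm, Real.rpow_mul two_pos.le, Real.rpow_logb two_pos (by norm_num) this,
    Real.rpow_natCast]

/-- In the variable `u = m^(3/4)` the power `m^d` is `u^(4d/3)`, which exponential decay beats; `m +
1 ≤ 2m` costs the factor `2^d`. -/
lemma tendsto_add_one_pow_mul_two_rpow (d : ℕ) :
    Tendsto (fun m : ℕ => ((m : ℝ) + 1) ^ d * (2 : ℝ) ^ (-(m : ℝ) ^ (3 / 4 : ℝ))) atTop (𝓝 0) := by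
  have hm : Tendsto (fun m : ℕ => (m : ℝ) ^ (3 / 4 : ℝ)) atTop atTop :=
    (tendsto_rpow_atTop (by norm_num)).comp tendsto_natCast_atTop_atTop
  have h := ((tendsto_rpow_mul_exp_neg_mul_atTop_nhds_zero (4 / 3 * d : ℝ) (Real.log 2)
    (Real.log_pos one_lt_two)).comp hm).const_mul ((2 : ℝ) ^ d)
  rw [mul_zero] at h
  refine squeeze_zero' (Eventually.of_forall fun m => by positivity) ?_ h
  filter_upwards [eventually_ge_atTop 1] with m hm1
  have hm1' : (1 : ℝ) ≤ m := by exact_mod_cast hm1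
  have h1 : ((m : ℝ) ^ (3 / 4 : ℝ)) ^ (4 / 3 * d : ℝ) = (m : ℝ) ^ d := by
    rw [← Real.rpow_mul (by positivity), ← Real.rpow_natCast]
    congr 1
    ring
  have h2 : (2 : ℝ) ^ (-(m : ℝ) ^ (3 / 4 : ℝ)) = Real.exp (-Real.log 2 * (m : ℝ) ^ (3 / 4 : ℝ)) := by
    rw [Real.rpow_def_of_pos two_pos]
    congr 1
    ring
  rw [Function.comp_apply, h1, h2, ← mul_assoc, ← mul_pow]
  gcongr
  linarith

lemma tendsto_natCast_rpow_neg {a : ℝ} (ha : 0 < a) :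
    Tendsto (fun m : ℕ => (m : ℝ) ^ (-a)) atTop (𝓝 0) :=
  (tendsto_rpow_neg_atTop ha).comp tendsto_natCast_atTop_atTop

end Asymptotics

/-- The number of maximally entangled states distilled from `m` copies. -/
noncomputable def distilledCopies (S : ℝ) (N m : ℕ) : ℕ :=
  ⌊(m * S - 2 * (m : ℝ) ^ (3 / 4 : ℝ)) / Real.logb 2 N⌋₊

lemma distilledCopies_le {S : ℝ} (hS : 0 ≤ S) {N : ℕ} (hN : 2 ≤ N) (m : ℕ) :
    (distilledCopies S N m : ℝ) ≤ m * S / Real.logb 2 N := by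
  have hL := one_le_logb_two hN
  refine (Nat.cast_le.2 (Nat.floor_mono ?_)).trans (Nat.floor_le (by positivity))
  gcongr
  have : 0 ≤ (m : ℝ) ^ (3 / 4 : ℝ) := by positivity
  linarith

/-- The `- 1` matters when no pair is produced: the exponent may then be negative, but blocks of
size 1 leave no remainder. Of the slack `2 m^(3/4)`, one half cancels the deviation `t = m^(3/4)`
and the other leaves the decay `2^(-m^(3/4))`. -/
lemma pow_distilledCopies_sub_one_le (S : ℝ) {N : ℕ} (hN : 2 ≤ N) (m : ℕ) :
    ((N ^ distilledCopies S N m - 1 : ℕ) : ℝ) ≤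
      (2 : ℝ) ^ (m * S - 2 * (m : ℝ) ^ (3 / 4 : ℝ)) := by
  have hL := one_le_logb_two hN
  rcases Nat.eq_zero_or_pos (distilledCopies S N m) with h | h
  · rw [h, pow_zero, Nat.sub_self, Nat.cast_zero]
    positivity
  · have h1 := Nat.floor_pos.1 h
    have h2 : (distilledCopies S N m : ℝ) ≤ _ := Nat.floor_le (zero_le_one.trans h1)
    rw [le_div_iff₀ (by positivity)] at h2
    calc ((N ^ distilledCopies S N m - 1 : ℕ) : ℝ) ≤ ((N ^ distilledCopies S N m : ℕ) : ℝ) :=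
          Nat.cast_le.2 (Nat.sub_le _ _)
      _ = (2 : ℝ) ^ (distilledCopies S N m * Real.logb 2 N) := by
          rw [two_rpow_mul_logb hN, Nat.cast_pow]
      _ ≤ _ := Real.rpow_le_rpow_of_exponent_le one_le_two h2

lemma tendsto_distilledCopies_div {S : ℝ} (hS : 0 ≤ S) {N : ℕ} (hN : 2 ≤ N) :
    Tendsto (fun m : ℕ => (distilledCopies S N m : ℝ) / m) atTop (𝓝 (S / Real.logb 2 N)) := by
  have hL := one_le_logb_two hN
  have hL0 : 0 < Real.logb 2 N := by positivity
  have hlow : Tendsto (fun m : ℕ => (S - 2 * (m : ℝ) ^ (-(1 / 4) : ℝ)) / Real.logb 2 N -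
      1 / (m : ℝ)) atTop (𝓝 (S / Real.logb 2 N)) := by
    have h := ((((tendsto_natCast_rpow_neg (a := 1 / 4) (by norm_num)).const_mul 2).const_sub
      S).div_const (Real.logb 2 N)).sub tendsto_one_div_atTop_nhds_zero_nat
    simpa using h
  refine tendsto_of_tendsto_of_tendsto_of_le_of_le' hlow tendsto_const_nhds ?_ ?_
  · filter_upwards [eventually_ge_atTop 1] with m hm
    have hm0 : (0 : ℝ) < m := by exact_mod_cast hm
    have h1 : (m * S - 2 * (m : ℝ) ^ (3 / 4 : ℝ)) / Real.logb 2 N - 1 ≤ distilledCopies S N m :=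
      (Nat.sub_one_lt_floor _).le
    have h2 : (m : ℝ) ^ (-(1 / 4) : ℝ) * m = (m : ℝ) ^ (3 / 4 : ℝ) := by
      rw [← Real.rpow_add_one hm0.ne']
      norm_num
    rw [le_div_iff₀ hm0]
    refine le_trans (le_of_eq ?_) h1
    rw [← h2]
    field_simp
  · filter_upwards [eventually_ge_atTop 1] with m hm
    have hm0 : (0 : ℝ) < m := by exact_mod_cast hm
    rw [div_le_iff₀ hm0]
    refine (distilledCopies_le hS hN m).trans (le_of_eq ?_)
    ring

end EntanglementDistillation

theorem mainTheorem3 {dA dB : ℕ}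
    (φ : EntanglementDistillation.BipartiteOp (Fin dA) (Fin dB))
    (hφ : EntanglementDistillation.IsPureState φ) (N : ℕ) (hN : 2 ≤ N) :
    -- the two reduced states have the same entropy
    EntanglementDistillation.vonNeumannEntropy (EntanglementDistillation.partialTraceB φ) =
        EntanglementDistillation.vonNeumannEntropy (EntanglementDistillation.partialTraceA φ) ∧
    -- some scheme has the rate `S(Tr_B φ) / log₂ N`, which is `S(Tr_B φ)` for `N = 2`
    (∃ (n : ℕ → ℕ) (T : ∀ m : ℕ,
        EntanglementDistillation.BipartiteOp (Fin m → Fin dA) (Fin m → Fin dB) →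
          EntanglementDistillation.BipartiteOp (Fin (n m) → Fin N) (Fin (n m) → Fin N)),
      EntanglementDistillation.IsDistillationScheme φ N n T ∧
      Tendsto (fun m : ℕ => (n m : ℝ) / (m : ℝ)) atTop
        (𝓝 (EntanglementDistillation.vonNeumannEntropy
          (EntanglementDistillation.partialTraceB φ) / Real.logb 2 N)) ∧
      (EntanglementDistillation.vonNeumannEntropy
          (EntanglementDistillation.partialTraceB φ) ≤ Real.logb 2 N → ∀ m, n m ≤ m)) ∧
    -- no scheme has a larger rate
    (∀ (n : ℕ → ℕ) (T : ∀ m : ℕ,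
        EntanglementDistillation.BipartiteOp (Fin m → Fin dA) (Fin m → Fin dB) →
          EntanglementDistillation.BipartiteOp (Fin (n m) → Fin N) (Fin (n m) → Fin N)),
      EntanglementDistillation.IsDistillationScheme φ N n T →
      ∀ ε : ℝ, 0 < ε → ∀ᶠ m : ℕ in atTop,
        (n m : ℝ) / (m : ℝ) ≤
          EntanglementDistillation.vonNeumannEntropy
            (EntanglementDistillation.partialTraceB φ) / Real.logb 2 N + ε) := by
  open EntanglementDistillation in
  obtain ⟨U, M, p, hU, hU', rfl, hM, hp, hp1, hS, hAB⟩ := hφ.exists_schmidt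
  have hS0 := shannonEntropy_nonneg hp hp1
  have hN0 : N ≠ 0 := by omega
  have hL := one_le_logb_two hN
  have hL0 : 0 < Real.logb 2 N := by positivity
  have hV := varentropy_nonneg hp
  refine ⟨hAB, ?_, ?_⟩
  · rw [hS]
    set n : ℕ → ℕ := distilledCopies (shannonEntropy p) N with hn
    have hex : ∀ m : ℕ, ∃ T : BipartiteOp (Fin m → Fin dA) (Fin m → Fin dB) →
        BipartiteOp (Fin (n m) → Fin N) (Fin (n m) → Fin N), IsLOCC T ∧ (0 < m →
          traceNorm (T (tensorPower (vecProj (U * M)) m) - tensorPower (maxEntangled N) (n m)) ≤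
            2 * (varentropy p * (m : ℝ) ^ (-(1 / 2) : ℝ) +
              ((m : ℝ) + 1) ^ dA * (2 : ℝ) ^ (-(m : ℝ) ^ (3 / 4 : ℝ)))) := by
      intro m
      -- At `m = 0` the deviation `m^(3/4)` is not positive; any LOCC map serves there.
      rcases Nat.eq_zero_or_pos m with h0 | h0
      · obtain ⟨T, hT, -⟩ := exists_LOCC_tensorPower hU hU' hM hp hp1 hN0 m (n m) one_pos
        exact ⟨T, hT, fun h => absurd h0 h.ne'⟩
      · have hm0 : (0 : ℝ) < m := by exact_mod_cast h0
        -- The exponent `3/4` exceeds `1/2`, so the Chebyshev term tends to 0, and is below 1, so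
        -- the rate is unaffected.
        obtain ⟨T, hT, hle⟩ := exists_LOCC_tensorPower hU hU' hM hp hp1 hN0 m (n m)
          (t := (m : ℝ) ^ (3 / 4 : ℝ)) (by positivity)
        refine ⟨T, hT, fun _ => hle.trans ?_⟩
        have h1 : m * varentropy p / ((m : ℝ) ^ (3 / 4 : ℝ)) ^ 2 =
            varentropy p * (m : ℝ) ^ (-(1 / 2) : ℝ) := by
          rw [← Real.rpow_natCast, ← Real.rpow_mul hm0.le, div_eq_mul_inv, ← Real.rpow_neg hm0.le,
            mul_comm (m : ℝ), mul_assoc]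
          nth_rewrite 1 [← Real.rpow_one (m : ℝ)]
          rw [← Real.rpow_add hm0]
          norm_num
        have h2 : ((N ^ n m - 1 : ℕ) : ℝ) *
            (2 : ℝ) ^ (-(m * shannonEntropy p) + (m : ℝ) ^ (3 / 4 : ℝ)) ≤
              (2 : ℝ) ^ (-(m : ℝ) ^ (3 / 4 : ℝ)) := by
          calc _ ≤ (2 : ℝ) ^ (m * shannonEntropy p - 2 * (m : ℝ) ^ (3 / 4 : ℝ)) *
                (2 : ℝ) ^ (-(m * shannonEntropy p) + (m : ℝ) ^ (3 / 4 : ℝ)) := by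
                gcongr
                exact pow_distilledCopies_sub_one_le _ hN m
            _ = _ := by
                rw [← Real.rpow_add two_pos]
                congr 1
                ring
        rw [h1, Fintype.card_fin]
        gcongr
    choose T hT hle using hex
    refine ⟨n, T, ⟨hT, ?_⟩, tendsto_distilledCopies_div hS0 hN, fun hSL m => ?_⟩
    · have hlim : Tendsto (fun m : ℕ => 2 * (varentropy p * (m : ℝ) ^ (-(1 / 2) : ℝ) +
          ((m : ℝ) + 1) ^ dA * (2 : ℝ) ^ (-(m : ℝ) ^ (3 / 4 : ℝ)))) atTop (𝓝 0) := by
        have h := (((tendsto_natCast_rpow_neg (a := 1 / 2) (by norm_num)).const_mul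
          (varentropy p)).add (tendsto_add_one_pow_mul_two_rpow dA)).const_mul 2
        simpa using h
      refine squeeze_zero' (Eventually.of_forall fun m => ?_) ?_ hlim
      · refine traceNorm_nonneg (((hT m).isHermitian ?_).sub ?_)
        · rw [tensorPower_vecProj]
          exact (vecProj_posSemidef _).1
        · rw [tensorPower_maxEntangled]
          exact (vecProj_posSemidef _).1
      · filter_upwards [eventually_gt_atTop 0] with m hm
        exact hle m hm
    · have h := distilledCopies_le hS0 hN m
      have h2 : (m : ℝ) * shannonEntropy p / Real.logb 2 N ≤ m := by
        rw [div_le_iff₀ hL0]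
        gcongr
      exact_mod_cast h.trans h2
  · rintro n T ⟨hT, hlim⟩ ε hε
    rw [hS]
    have hvar : Tendsto (fun m : ℕ => varentropy p / (ε / 2) ^ 2 / (m : ℝ)) atTop (𝓝 0) :=
      tendsto_const_div_atTop_nhds_zero_nat _
    -- An error below `1/4` and a Chebyshev term below `1/8` force the rank ratio to be at least
    -- `1/4`. This costs two bits, which `m ≥ 4 / ε` absorbs into `m ε / 2`.
    filter_upwards [hlim.eventually_lt_const (show (0 : ℝ) < 1 / 4 by norm_num),
      hvar.eventually_lt_const (show (0 : ℝ) < 1 / 8 by norm_num),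
      eventually_ge_atTop ⌈4 / ε⌉₊, eventually_gt_atTop 0] with m h1 h2 h3 h4
    have hm0 : (0 : ℝ) < m := by exact_mod_cast h4
    have h5 := one_sub_traceNorm_tensorPower_le hU hM hp hp1 hN0
      (t := m * (ε / 2)) (by positivity) (hT m)
    have h6 : m * varentropy p / (m * (ε / 2)) ^ 2 = varentropy p / (ε / 2) ^ 2 / (m : ℝ) := by
      field_simp
    rw [h6] at h5
    have hNn : (0 : ℝ) < (N : ℝ) ^ n m := by positivity
    have h7 : (1 / 4 : ℝ) ≤
        (2 : ℝ) ^ (m * shannonEntropy p + m * (ε / 2)) / (N : ℝ) ^ n m := by linarith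
    rw [le_div_iff₀ hNn] at h7
    have h8 : (2 : ℝ) ^ (n m * Real.logb 2 N) ≤
        (2 : ℝ) ^ (2 + (m * shannonEntropy p + m * (ε / 2))) := by
      rw [two_rpow_mul_logb hN, Real.rpow_add two_pos]
      norm_num
      linarith
    have h9 := (Real.rpow_le_rpow_left_iff one_lt_two).1 h8
    have h10 : 4 ≤ m * ε := by
      have := Nat.ceil_le.1 h3
      rwa [div_le_iff₀ hε] at this
    rw [div_add' _ _ _ hL0.ne', div_le_div_iff₀ hm0 hL0]
    -- Since `log₂ N ≥ 1`, the excess `m ε` is at most `m ε log₂ N`.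
    nlinarith [mul_le_mul_of_nonneg_left hL (mul_pos hm0 hε).le]
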